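/- Let $N\ge 1$, let $\Omega\subset\mathbb R^N$ be a bounded open set, and let $0<m<1$. For $s\ge 0$ put $$H(s)=\int_0^s \exp\Big(\frac{t^{\frac{2-m}{m}}}{m(2-m)}\Big)\,dt,\qquad \beta(s)=\frac1m\int_0^s \big(H^{-1}(\sigma)\big)^{\frac1m-1}\,d\sigma .$$ Let $u_0\ge 0$ satisfy $u_0\in L^{1+\theta_0}(\Omega)$ for some $\theta_0>0$. For $T>0$, a function $u\ge 0$ on $\Omega\times[0,T]$ is called a regular solution in $\Omega\times(0,T)$ of $$u_t-\Delta u^m=|\nabla u|^2\ \text{ in }\Omega\times(0,T),\qquad u=0\ \text{ on }\partial\Omega\times(0,T),\qquad u(\cdot,0)=u_0\ \text{ in }\Omega,$$ if $u(\cdot,0)=u_0$ a.e. in $\Omega$ and the function $v=H(u^m)$ satisfies $$v\in L^2\big(0,T;W^{1,2}_0(\Omega)\big)\cap \mathcal C\big([0,T];L^2(\Omega)\big),\qquad \beta(v)_t\in L^2\big(0,T;W^{-1,2}(\Omega)\big),$$ and, for all $\phi\in L^2(0,T;W^{1,2}_0(\Omega))$, $$\int_0^T\langle \beta(v)_t,\phi\rangle\,dt+\int_0^T\!\!\int_\Omega\nabla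 v\cdot\nabla\phi\,dx\,dt=0 .$$ Here $W^{1,2}_0(\Omega)$ is the closure of $C_c^\infty(\Omega)$ in $W^{1,2}(\Omega)$, $W^{-1,2}(\Omega)$ is its dual, and $\beta(v)_t$ is the time derivative in the sense of distributions. Then there is a finite time $t_0>0$, depending only on $N$, $m$, $\Omega$ and $u_0$ (in particular not on $T$), such that for every $T>0$ every regular solution $u$ in $\Omega\times(0,T)$ satisfies $u(\cdot,t)=0$ a.e. in $\Omega$ for all $t\in(t_0,T]$. -/

import Mathlib

open MeasureTheory Set TopologicalSpace
open scoped Distributions ContDiff ENNReal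

noncomputable section

namespace FastDiffusion

/-! ### The Sobolev space `W₀^{1,2}(Ω)` and its dual -/

/-- The Euclidean space `ℝ^N`. -/
abbrev Eucl (N : ℕ) : Type := EuclideanSpace ℝ (Fin N)

/-- `L²(Ω)`. -/
abbrev L2 {N : ℕ} (Ω : Opens (Eucl N)) : Type :=
  Lp ℝ 2 (volume.restrict (Ω : Set (Eucl N)))

/-- `L²(Ω; ℝ^N)`. -/
abbrev L2Vec {N : ℕ} (Ω : Opens (Eucl N)) : Type :=
  Lp (Eucl N) 2 (volume.restrict (Ω : Set (Eucl N)))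

/-- The Hilbert space `L²(Ω) × L²(Ω; ℝ^N)` of pairs (function, vector field), with the norm
`(‖f‖² + ‖F‖²)^{1/2}`. -/
abbrev L2Pair {N : ℕ} (Ω : Opens (Eucl N)) : Type :=
  WithLp 2 (L2 Ω × L2Vec Ω)

theorem memLp_test {N : ℕ} {Ω : Opens (Eucl N)} (η : 𝓓(Ω, ℝ)) :
    MemLp (fun x => η x) 2 (volume.restrict (Ω : Set (Eucl N))) :=
  η.continuous.memLp_of_hasCompactSupport η.hasCompactSupport

theorem memLp_gradient_test {N : ℕ} {Ω : Opens (Eucl N)} (η : 𝓓(Ω, ℝ)) :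
    MemLp (fun x => gradient (fun y => η y) x) 2 (volume.restrict (Ω : Set (Eucl N))) := by
  have hc : Continuous (fun x => gradient (fun y => η y) x) :=
    (InnerProductSpace.toDual ℝ (Eucl N)).symm.continuous.comp
      (η.contDiff.continuous_fderiv (by simp))
  refine hc.memLp_of_hasCompactSupport ?_
  exact (η.hasCompactSupport.fderiv (𝕜 := ℝ)).comp_left
    (g := (InnerProductSpace.toDual ℝ (Eucl N)).symm) (map_zero _)

/-- A test function `η ∈ C_c^∞(Ω)`, seen as the pair `(η, ∇η)`. -/
def testPair {N : ℕ} {Ω : Opens (Eucl N)} (η : 𝓓(Ω, ℝ)) : L2Pair Ω :=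
  WithLp.toLp 2 ((memLp_test η).toLp _, (memLp_gradient_test η).toLp _)

/-- The closure of `C_c^∞(Ω)`, seen as pairs `(η, ∇η)`, in the norm `(‖η‖² + ‖∇η‖²)^{1/2}`. -/
def W012Sub {N : ℕ} (Ω : Opens (Eucl N)) : Submodule ℝ (L2Pair Ω) :=
  (Submodule.span ℝ (range (testPair (Ω := Ω)))).topologicalClosure

/-- `W₀^{1,2}(Ω)`: the closure of `C_c^∞(Ω)` in the norm `(‖f‖² + ‖∇f‖²)^{1/2}`, a Hilbert space.
An element is stored as the pair `(f, ∇f)`, where `∇f` is the weak gradient of `f`. -/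
def W012 {N : ℕ} (Ω : Opens (Eucl N)) : Type := ↥(W012Sub Ω)

instance {N : ℕ} (Ω : Opens (Eucl N)) : NormedAddCommGroup (W012 Ω) :=
  inferInstanceAs (NormedAddCommGroup ↥(W012Sub Ω))

instance {N : ℕ} (Ω : Opens (Eucl N)) : InnerProductSpace ℝ (W012 Ω) :=
  inferInstanceAs (InnerProductSpace ℝ ↥(W012Sub Ω))

instance {N : ℕ} (Ω : Opens (Eucl N)) : CompleteSpace (W012 Ω) :=
  (Submodule.isClosed_topologicalClosure _).completeSpace_coe

/-- The underlying `L²` function of an element of `W₀^{1,2}(Ω)`. -/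
def W012.fn {N : ℕ} {Ω : Opens (Eucl N)} (f : W012 Ω) : L2 Ω := (Subtype.val f : L2Pair Ω).fst

/-- The weak gradient of an element of `W₀^{1,2}(Ω)`. -/
def W012.grad {N : ℕ} {Ω : Opens (Eucl N)} (f : W012 Ω) : L2Vec Ω := (Subtype.val f : L2Pair Ω).snd

/-- A test function as an element of `W₀^{1,2}(Ω)`. -/
def W012.ofTest {N : ℕ} {Ω : Opens (Eucl N)} (η : 𝓓(Ω, ℝ)) : W012 Ω :=
  ⟨testPair η, Submodule.le_topologicalClosure _ (Submodule.subset_span ⟨η, rfl⟩)⟩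

/-- `W^{-1,2}(Ω)`: the dual of `W₀^{1,2}(Ω)`. -/
abbrev WNeg12 {N : ℕ} (Ω : Opens (Eucl N)) : Type := StrongDual ℝ (W012 Ω)

/-! ### The change of unknown -/

/-- `H(s) = ∫₀ˢ exp (t^{(2-m)/m} / (m (2-m))) dt`, for `s ≥ 0`. -/
def H (m s : ℝ) : ℝ :=
  ∫ t in (0 : ℝ)..s, Real.exp (t ^ ((2 - m) / m) / (m * (2 - m)))

/-- The inverse of `H`, as a function from `[0, ∞)` to `[0, ∞)`. -/
def Hinv (m σ : ℝ) : ℝ := Function.invFunOn (H m) (Ici 0) σ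

/-- `β(s) = (1/m) ∫₀ˢ (H⁻¹(σ))^{1/m - 1} dσ`, for `s ≥ 0`. -/
def beta (m s : ℝ) : ℝ :=
  (1 / m) * ∫ σ in (0 : ℝ)..s, (Hinv m σ) ^ (1 / m - 1)

/-! ### Regular solutions -/

/-- `G : (0,T) → W^{-1,2}(Ω)` is the time derivative, in the sense of (vector valued)
distributions on `(0,T)`, of `w : (0,T) → L¹_loc(Ω)`:
`∫₀ᵀ ψ'(t) (∫_Ω w(t) η) dt = - ∫₀ᵀ ψ(t) ⟨G(t), η⟩ dt`
for all `ψ ∈ C_c^∞((0,T))` and `η ∈ C_c^∞(Ω)`. -/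
def IsWeakTimeDeriv {N : ℕ} (Ω : Opens (Eucl N)) (T : ℝ) (w : ℝ → Eucl N → ℝ)
    (G : ℝ → WNeg12 Ω) : Prop :=
  ∀ (ψ : 𝓓((⟨Ioo 0 T, isOpen_Ioo⟩ : Opens ℝ), ℝ)) (η : 𝓓(Ω, ℝ)),
    ∫ t in Ioo 0 T, deriv (fun s => ψ s) t * ∫ x in (Ω : Set (Eucl N)), w t x * η x =
      - ∫ t in Ioo 0 T, ψ t * G t (W012.ofTest η)

/-- `u = u(t,x)` is a regular solution in `Ω × (0,T)` of `u_t - Δ u^m = |∇u|²`, `u ≥ 0`, with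
`u = 0` on `∂Ω × (0,T)` and `u(0) = u₀`. With `v = H(u^m)`, this means
`v ∈ L²(0,T; W₀^{1,2}(Ω)) ∩ C([0,T]; L²(Ω))`, `β(v)_t ∈ L²(0,T; W^{-1,2}(Ω))`, and
`∫₀ᵀ ⟨β(v)_t, φ⟩ + ∫₀ᵀ ∫_Ω ∇v · ∇φ = 0` for every `φ ∈ L²(0,T; W₀^{1,2}(Ω))`.

In `regular`, `Vc` is `v` as a continuous curve in `L²(Ω)`, `V` is `v` as a curve in
`W₀^{1,2}(Ω)`, and `G` is `β(v)_t`. -/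
structure IsRegularSolution {N : ℕ} (m : ℝ) (Ω : Opens (Eucl N)) (u₀ : Eucl N → ℝ) (T : ℝ)
    (u : ℝ → Eucl N → ℝ) : Prop where
  nonneg : ∀ t ∈ Icc 0 T, ∀ᵐ x ∂(volume.restrict (Ω : Set (Eucl N))), 0 ≤ u t x
  initial : ∀ᵐ x ∂(volume.restrict (Ω : Set (Eucl N))), u 0 x = u₀ x
  regular :
    ∃ (Vc : ℝ → L2 Ω) (V : ℝ → W012 Ω) (G : ℝ → WNeg12 Ω),
      (∀ t ∈ Icc 0 T,
        ∀ᵐ x ∂(volume.restrict (Ω : Set (Eucl N))), Vc t x = H m (u t x ^ m)) ∧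
      ContinuousOn Vc (Icc 0 T) ∧
      (∀ᵐ t ∂(volume.restrict (Ioo 0 T)), (V t).fn = Vc t) ∧
      MemLp V 2 (volume.restrict (Ioo 0 T)) ∧
      MemLp G 2 (volume.restrict (Ioo 0 T)) ∧
      IsWeakTimeDeriv Ω T (fun t x => beta m (H m (u t x ^ m))) G ∧
      ∀ φ : ℝ → W012 Ω, MemLp φ 2 (volume.restrict (Ioo 0 T)) →
        (∫ t in Ioo 0 T, G t (φ t)) +
          (∫ t in Ioo 0 T, ∫ x in (Ω : Set (Eucl N)),
            inner ℝ ((V t).grad x) ((φ t).grad x)) = 0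

end FastDiffusion

end

namespace FastDiffusion

theorem continuous_H_integrand {m : ℝ} (hm0 : 0 < m) (hm1 : m < 1) :
    Continuous fun t : ℝ => Real.exp (t ^ ((2 - m) / m) / (m * (2 - m))) := by
  have h : 0 ≤ (2 - m) / m := div_nonneg (by linarith) hm0.le
  exact ((Real.continuous_rpow_const h).div_const _).rexp

theorem strictMono_H {m : ℝ} (hm0 : 0 < m) (hm1 : m < 1) : StrictMono (H m) := by
  intro a b hab
  have hc := continuous_H_integrand hm0 hm1
  have h := intervalIntegral.integral_interval_sub_left (hc.intervalIntegrable 0 b)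
    (hc.intervalIntegrable 0 a) (μ := volume)
  have hpos : 0 < ∫ t in a..b, Real.exp (t ^ ((2 - m) / m) / (m * (2 - m))) :=
    intervalIntegral.intervalIntegral_pos_of_pos (hc.intervalIntegrable a b)
      (fun _ => Real.exp_pos _) hab
  unfold H
  linarith

theorem continuous_H {m : ℝ} (hm0 : 0 < m) (hm1 : m < 1) : Continuous (H m) :=
  intervalIntegral.continuous_primitive
    (fun a b => (continuous_H_integrand hm0 hm1).intervalIntegrable a b) 0

theorem H_zero (m : ℝ) : H m 0 = 0 := by simp [H]

theorem rpow_le_H {m : ℝ} (hm0 : 0 < m) (hm1 : m < 1) (n : ℕ) {z : ℝ} (hz : 0 ≤ z) :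
    z ^ ((2 - m) / m * n + 1) / ((m * (2 - m)) ^ n * n.factorial * ((2 - m) / m * n + 1)) ≤
      H m z := by
  have hγ : 0 ≤ (2 - m) / m := div_nonneg (by linarith) hm0.le
  have hγn : 0 ≤ (2 - m) / m * n := by positivity
  have hK : 0 < m * (2 - m) := mul_pos hm0 (by linarith)
  have h1 : ∫ t in (0 : ℝ)..z, t ^ ((2 - m) / m * n) / ((m * (2 - m)) ^ n * n.factorial) =
      z ^ ((2 - m) / m * n + 1) /
        ((m * (2 - m)) ^ n * n.factorial * ((2 - m) / m * n + 1)) := by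
    rw [intervalIntegral.integral_div, integral_rpow (Or.inl (by linarith)),
      Real.zero_rpow (by linarith)]
    rw [sub_zero, div_div, mul_comm (_ + 1)]
  rw [← h1]
  refine intervalIntegral.integral_mono_on hz ?_
    ((continuous_H_integrand hm0 hm1).intervalIntegrable _ _) fun t ht => ?_
  · exact ((Real.continuous_rpow_const hγn).div_const _).intervalIntegrable _ _
  · refine le_trans (le_of_eq ?_) (Real.pow_div_factorial_le_exp _ (by
      have := ht.1; positivity) n)
    rw [Real.rpow_mul ht.1, Real.rpow_natCast, div_pow, div_div]

theorem le_H {m : ℝ} (hm0 : 0 < m) (hm1 : m < 1) {z : ℝ} (hz : 0 ≤ z) : z ≤ H m z := by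
  simpa using rpow_le_H hm0 hm1 0 hz

theorem Hinv_spec {m : ℝ} (hm0 : 0 < m) (hm1 : m < 1) {σ : ℝ} (hσ : 0 ≤ σ) :
    0 ≤ Hinv m σ ∧ H m (Hinv m σ) = σ := by
  have hex : ∃ a ∈ Ici (0 : ℝ), H m a = σ := by
    obtain ⟨a, ha, h⟩ := intermediate_value_Icc hσ (continuous_H hm0 hm1).continuousOn
      (⟨by simpa [H_zero] using hσ, le_H hm0 hm1 hσ⟩ : σ ∈ Icc (H m 0) (H m σ))
    exact ⟨a, ha.1, h⟩
  exact ⟨Function.invFunOn_mem hex, Function.invFunOn_eq hex⟩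

/-- The derivative of `beta m`, extended by zero to the negative half-line. -/
noncomputable def betaDeriv (m s : ℝ) : ℝ := 1 / m * Hinv m (max s 0) ^ (1 / m - 1)

/-- Properties of the derivative of the nonlinearity in `(B v)_t = Δ v` used for extinction:
it is monotone, vanishes exactly on the negative half-line, and is dominated by every power of
order at most `e₀`. -/
structure IsSlowRate (b : ℝ → ℝ) (e₀ : ℝ) : Prop where
  mono : Monotone b
  of_nonpos : ∀ s ≤ 0, b s = 0
  pos : ∀ s, 0 < s → 0 < b s
  growth : ∀ e, 0 < e → e ≤ e₀ → ∃ C, 0 < C ∧ ∀ s, 0 ≤ s → b s ≤ C * s ^ e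

theorem Hinv_zero {m : ℝ} (hm0 : 0 < m) (hm1 : m < 1) : Hinv m 0 = 0 :=
  (strictMono_H hm0 hm1).injective
    ((Hinv_spec hm0 hm1 le_rfl).2.trans (H_zero m).symm)

theorem betaDeriv_le {m : ℝ} (hm0 : 0 < m) (hm1 : m < 1) (n : ℕ) :
    ∃ C, 0 < C ∧ ∀ s, 0 ≤ s →
      betaDeriv m s ≤ C * s ^ ((1 / m - 1) / ((2 - m) / m * n + 1)) := by
  have hγ : 0 ≤ (2 - m) / m := div_nonneg (by linarith) hm0.le
  have hq : 0 < (2 - m) / m * n + 1 := by positivity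
  have hK : 0 < m * (2 - m) := mul_pos hm0 (by linarith)
  have he : 0 < 1 / m - 1 := by
    rw [sub_pos, lt_div_iff₀ hm0]; linarith
  set q := (2 - m) / m * n + 1
  set K := (m * (2 - m)) ^ n * n.factorial * q with hKdef
  have hKpos : 0 < K := by positivity
  refine ⟨1 / m * K ^ ((1 / m - 1) / q), by positivity, fun s hs => ?_⟩
  obtain ⟨h0, h1⟩ := Hinv_spec hm0 hm1 hs
  have h2 := rpow_le_H hm0 hm1 n h0
  rw [h1, div_le_iff₀ hKpos] at h2
  rw [betaDeriv, max_eq_left hs, mul_assoc, ← Real.mul_rpow hKpos.le hs]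
  refine mul_le_mul_of_nonneg_left ?_ (by positivity)
  calc Hinv m s ^ (1 / m - 1) = (Hinv m s ^ q) ^ ((1 / m - 1) / q) := by
        rw [← Real.rpow_mul h0]; congr 1; field_simp
    _ ≤ (K * s) ^ ((1 / m - 1) / q) :=
        Real.rpow_le_rpow (Real.rpow_nonneg h0 _) (by linarith) (by positivity)

theorem isSlowRate_betaDeriv {m : ℝ} (hm0 : 0 < m) (hm1 : m < 1) :
    IsSlowRate (betaDeriv m) (1 / m - 1) := by
  have he : 0 < 1 / m - 1 := by
    rw [sub_pos, lt_div_iff₀ hm0]; linarith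
  have hγ : 0 < (2 - m) / m := div_pos (by linarith) hm0
  refine ⟨fun a c hac => ?_, fun s hs => ?_, fun s hs => ?_, fun e he0 hee => ?_⟩
  · obtain ⟨h0, h1⟩ := Hinv_spec hm0 hm1 (le_max_right a 0)
    obtain ⟨h2, h3⟩ := Hinv_spec hm0 hm1 (le_max_right c 0)
    refine mul_le_mul_of_nonneg_left (Real.rpow_le_rpow h0 ?_ he.le) (by positivity)
    rw [← (strictMono_H hm0 hm1).le_iff_le, h1, h3]
    exact max_le_max_right 0 hac
  · rw [betaDeriv, max_eq_right hs, Hinv_zero hm0 hm1, Real.zero_rpow he.ne', mul_zero]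
  · obtain ⟨h0, h1⟩ := Hinv_spec hm0 hm1 hs.le
    rw [betaDeriv, max_eq_left hs.le]
    have : 0 < Hinv m s := by
      refine h0.lt_of_ne fun h => ?_
      rw [← h, H_zero] at h1
      exact hs.ne h1
    positivity
  · obtain ⟨n, hn⟩ := exists_nat_gt ((1 / m - 1) / e / ((2 - m) / m))
    obtain ⟨C0, hC0, h0⟩ := betaDeriv_le hm0 hm1 0
    obtain ⟨Cn, hCn, h1⟩ := betaDeriv_le hm0 hm1 n
    refine ⟨max C0 Cn, by positivity, fun s hs => ?_⟩
    rcases le_total s 1 with h | h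
    · rcases hs.eq_or_lt with rfl | hs'
      · refine (h0 0 le_rfl).trans ?_
        rw [Real.zero_rpow he0.ne', Real.zero_rpow (by simpa using he.ne')]; simp
      refine (h0 s hs).trans (mul_le_mul (le_max_left _ _) ?_ (by positivity) (by positivity))
      exact Real.rpow_le_rpow_of_exponent_ge hs' h (by simpa using hee)
    · refine (h1 s hs).trans (mul_le_mul (le_max_right _ _) ?_ (by positivity) (by positivity))
      refine Real.rpow_le_rpow_of_exponent_le h ?_
      rw [div_lt_iff₀ hγ, div_lt_iff₀ he0] at hn
      rw [div_le_iff₀ (by positivity)]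
      nlinarith

theorem beta_eq_integral_betaDeriv (m : ℝ) {s : ℝ} (hs : 0 ≤ s) :
    beta m s = ∫ σ in (0 : ℝ)..s, betaDeriv m σ := by
  rw [beta, ← intervalIntegral.integral_const_mul]
  refine intervalIntegral.integral_congr fun σ hσ => ?_
  rw [uIcc_of_le hs] at hσ
  simp [betaDeriv, max_eq_left hσ.1]

/-- The primitive `B` of a rate `b`. -/
noncomputable def ratePrim (b : ℝ → ℝ) (s : ℝ) : ℝ := ∫ σ in (0 : ℝ)..s, b σ

/-- The energy density `∫₀ˢ arsinh dB`. -/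
noncomputable def rateEnergy (b : ℝ → ℝ) (s : ℝ) : ℝ := ∫ σ in (0 : ℝ)..s, Real.arsinh σ * b σ

theorem arsinh_le_self {s : ℝ} (hs : 0 ≤ s) : Real.arsinh s ≤ s := by
  have := Real.arsinh_le_arsinh.2 (Real.self_le_sinh_iff.2 hs)
  rwa [Real.arsinh_sinh] at this

theorem arsinh_le_rpow {δ s : ℝ} (hδ : 0 < δ) (hs : 1 ≤ s) :
    Real.arsinh s ≤ 3 ^ δ / δ * s ^ δ := by
  have h1 : √(1 + s ^ 2) ≤ 2 * s := by
    rw [Real.sqrt_le_left (by linarith)]; nlinarith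
  have h2 : 0 ≤ s + √(1 + s ^ 2) := by positivity
  calc Real.arsinh s ≤ (s + √(1 + s ^ 2)) ^ δ / δ := Real.log_le_rpow_div h2 hδ
    _ ≤ (3 * s) ^ δ / δ := by
        gcongr; linarith
    _ = 3 ^ δ / δ * s ^ δ := by rw [Real.mul_rpow (by norm_num) (by linarith)]; ring

/-- A function comparable to `min s √s`, whose squared derivative is dominated by that of
`arsinh`. -/
noncomputable def sublin (s : ℝ) : ℝ := s * (1 + s ^ 2) ^ (-(1 / 4) : ℝ)

namespace IsSlowRate

variable {b : ℝ → ℝ} {e₀ : ℝ}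

theorem nonneg (hb : IsSlowRate b e₀) (s : ℝ) : 0 ≤ b s := by
  rcases le_or_gt s 0 with h | h
  · exact (hb.of_nonpos s h).ge
  · exact (hb.pos s h).le

theorem intervalIntegrable (hb : IsSlowRate b e₀) (x y : ℝ) :
    IntervalIntegrable b volume x y := hb.mono.intervalIntegrable

theorem intervalIntegrable_arsinh_mul (hb : IsSlowRate b e₀) (x y : ℝ) :
    IntervalIntegrable (fun σ => Real.arsinh σ * b σ) volume x y :=
  (hb.intervalIntegrable x y).continuousOn_mul Real.continuous_arsinh.continuousOn

theorem ratePrim_sub (hb : IsSlowRate b e₀) (x y : ℝ) :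
    ratePrim b y - ratePrim b x = ∫ σ in x..y, b σ :=
  intervalIntegral.integral_interval_sub_left (hb.intervalIntegrable _ _)
    (hb.intervalIntegrable _ _)

theorem rateEnergy_sub (hb : IsSlowRate b e₀) (x y : ℝ) :
    rateEnergy b y - rateEnergy b x = ∫ σ in x..y, Real.arsinh σ * b σ :=
  intervalIntegral.integral_interval_sub_left (hb.intervalIntegrable_arsinh_mul _ _)
    (hb.intervalIntegrable_arsinh_mul _ _)

theorem arsinh_mul_nonneg (hb : IsSlowRate b e₀) (s : ℝ) : 0 ≤ Real.arsinh s * b s := by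
  rcases le_or_gt s 0 with h | h
  · simp [hb.of_nonpos s h]
  · exact mul_nonneg (Real.arsinh_nonneg_iff.2 h.le) (hb.nonneg s)

/-- The energy density is a convex function of `B`, with slope `arsinh`. -/
theorem rateEnergy_sub_le (hb : IsSlowRate b e₀) (a c : ℝ) :
    rateEnergy b a - rateEnergy b c ≤ Real.arsinh a * (ratePrim b a - ratePrim b c) := by
  rw [hb.rateEnergy_sub, hb.ratePrim_sub, ← intervalIntegral.integral_const_mul]
  rcases le_total c a with h | h
  · refine intervalIntegral.integral_mono_on h (hb.intervalIntegrable_arsinh_mul _ _)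
      ((hb.intervalIntegrable _ _).const_mul _) fun σ hσ => ?_
    exact mul_le_mul_of_nonneg_right (Real.arsinh_le_arsinh.2 hσ.2) (hb.nonneg σ)
  · rw [intervalIntegral.integral_symm, intervalIntegral.integral_symm a c]
    refine neg_le_neg <| intervalIntegral.integral_mono_on h ((hb.intervalIntegrable _ _).const_mul _)
      (hb.intervalIntegrable_arsinh_mul _ _) fun σ hσ => ?_
    exact mul_le_mul_of_nonneg_right (Real.arsinh_le_arsinh.2 hσ.1) (hb.nonneg σ)

theorem rateEnergy_of_nonpos (hb : IsSlowRate b e₀) {s : ℝ} (hs : s ≤ 0) :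
    rateEnergy b s = 0 := by
  rw [rateEnergy, intervalIntegral.integral_congr (g := fun _ => 0) fun σ hσ => ?_]
  · simp
  · rw [uIcc_of_ge hs] at hσ
    simp [hb.of_nonpos σ hσ.2]

theorem ratePrim_of_nonpos (hb : IsSlowRate b e₀) {s : ℝ} (hs : s ≤ 0) :
    ratePrim b s = 0 := by
  rw [ratePrim, intervalIntegral.integral_congr (g := fun _ => 0) fun σ hσ => ?_]
  · simp
  · rw [uIcc_of_ge hs] at hσ
    simp [hb.of_nonpos σ hσ.2]

theorem rateEnergy_pos (hb : IsSlowRate b e₀) {s : ℝ} (hs : 0 < s) : 0 < rateEnergy b s :=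
  intervalIntegral.intervalIntegral_pos_of_pos_on (hb.intervalIntegrable_arsinh_mul _ _)
    (fun _ hx => mul_pos (Real.arsinh_pos_iff.2 hx.1) (hb.pos _ hx.1)) hs

theorem rateEnergy_nonneg (hb : IsSlowRate b e₀) (s : ℝ) : 0 ≤ rateEnergy b s := by
  rcases le_or_gt s 0 with h | h
  · exact (hb.rateEnergy_of_nonpos h).ge
  · exact (hb.rateEnergy_pos h).le

theorem ratePrim_nonneg (hb : IsSlowRate b e₀) (s : ℝ) : 0 ≤ ratePrim b s := by
  rcases le_total s 0 with h | h
  · exact (hb.ratePrim_of_nonpos h).ge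
  · exact intervalIntegral.integral_nonneg h fun σ _ => hb.nonneg σ

/-- A rate bounded by an affine function has a primitive that is locally Lipschitz, with a constant
of affine growth. -/
theorem abs_integral_le {p : ℝ → ℝ} {C : ℝ} (hC : 0 ≤ C) (hp : ∀ s, |p s| ≤ C * (1 + |s|))
    (a c : ℝ) : |∫ σ in c..a, p σ| ≤ C * (1 + |a| + |c|) * |a - c| := by
  rw [← Real.norm_eq_abs (∫ σ in c..a, p σ)]
  refine intervalIntegral.norm_integral_le_of_norm_le_const fun σ hσ =>
    (le_of_eq (Real.norm_eq_abs _)).trans ((hp σ).trans ?_)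
  refine mul_le_mul_of_nonneg_left ?_ hC
  have h1 : |σ| ≤ |a| + |c| := by
    rcases mem_uIoc.1 hσ with h | h <;>
    · refine abs_le.2 ⟨?_, ?_⟩ <;>
      linarith [neg_abs_le a, neg_abs_le c, le_abs_self a, le_abs_self c, h.1, h.2, abs_nonneg a,
        abs_nonneg c]
  linarith

theorem rpow_le_one_add {s e : ℝ} (hs : 0 ≤ s) (he : 0 ≤ e) (he1 : e ≤ 1) : s ^ e ≤ 1 + s := by
  rcases le_total s 1 with h | h
  · exact (Real.rpow_le_one hs h he).trans (by linarith)
  · exact (Real.rpow_le_rpow_of_exponent_le h he1).trans (by rw [Real.rpow_one]; linarith)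

theorem exists_ratePrim_lipschitz (hb : IsSlowRate b e₀) (he₀ : 0 < e₀) :
    ∃ C, 0 ≤ C ∧ ∀ a c, |ratePrim b a - ratePrim b c| ≤ C * (1 + |a| + |c|) * |a - c| := by
  obtain ⟨C, hC, h⟩ := hb.growth (min e₀ 1) (by positivity) (min_le_left _ _)
  refine ⟨C, hC.le, fun a c => ?_⟩
  rw [hb.ratePrim_sub]
  refine abs_integral_le hC.le (fun s => ?_) a c
  rw [abs_of_nonneg (hb.nonneg s)]
  rcases le_total s 0 with hs | hs
  · rw [hb.of_nonpos s hs]; positivity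
  · refine (h s hs).trans (mul_le_mul_of_nonneg_left ?_ hC.le)
    rw [abs_of_nonneg hs]
    exact rpow_le_one_add hs (by positivity) (min_le_right _ _)

theorem exists_rateEnergy_lipschitz (hb : IsSlowRate b e₀) (he₀ : 0 < e₀) :
    ∃ C, 0 ≤ C ∧ ∀ a c, |rateEnergy b a - rateEnergy b c| ≤ C * (1 + |a| + |c|) * |a - c| := by
  obtain ⟨C, hC, h⟩ := hb.growth (min e₀ (1 / 2)) (by positivity) (min_le_left _ _)
  refine ⟨3 ^ (1 / 2 : ℝ) / (1 / 2) * C + C, by positivity, fun a c => ?_⟩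
  rw [hb.rateEnergy_sub]
  refine abs_integral_le (by positivity) (fun s => ?_) a c
  rw [abs_of_nonneg (hb.arsinh_mul_nonneg s)]
  rcases le_total s 0 with hs | hs
  · rw [hb.of_nonpos s hs, mul_zero]; positivity
  rw [abs_of_nonneg hs]
  have he : 0 < min e₀ (1 / 2) := by positivity
  rcases le_total s 1 with h1 | h1
  · have h2 : b s ≤ C * 1 := (h s hs).trans
      (mul_le_mul_of_nonneg_left (Real.rpow_le_one hs h1 he.le) hC.le)
    calc Real.arsinh s * b s ≤ 1 * (C * 1) :=
          mul_le_mul ((arsinh_le_self hs).trans h1) h2 (hb.nonneg s) zero_le_one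
      _ ≤ _ := by
          have : 0 ≤ 3 ^ (1 / 2 : ℝ) / (1 / 2) * C := by positivity
          nlinarith
  · have h2 : b s ≤ C * s ^ (1 / 2 : ℝ) := (h s hs).trans
      (mul_le_mul_of_nonneg_left (Real.rpow_le_rpow_of_exponent_le h1 (min_le_right _ _)) hC.le)
    calc Real.arsinh s * b s ≤ (3 ^ (1 / 2 : ℝ) / (1 / 2) * s ^ (1 / 2 : ℝ)) *
            (C * s ^ (1 / 2 : ℝ)) :=
          mul_le_mul (arsinh_le_rpow (by norm_num) h1) h2 (hb.nonneg s) (by positivity)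
      _ = 3 ^ (1 / 2 : ℝ) / (1 / 2) * C * s := by
          have : s ^ (1 / 2 : ℝ) * s ^ (1 / 2 : ℝ) = s := by
            rw [← Real.rpow_add (by linarith)]; norm_num
          linear_combination (3 ^ (1 / 2 : ℝ) / (1 / 2) * C) * this
      _ ≤ _ := by
          have : 0 ≤ 3 ^ (1 / 2 : ℝ) / (1 / 2) * C := by positivity
          nlinarith

theorem exists_ratePrim_le (hb : IsSlowRate b e₀) {e : ℝ} (he : 0 < e) (hee : e ≤ e₀) :
    ∃ C, 0 < C ∧ ∀ s, ratePrim b s ≤ C * |s| ^ (1 + e) := by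
  obtain ⟨C, hC, h⟩ := hb.growth e he hee
  refine ⟨C, hC, fun s => ?_⟩
  rcases le_total s 0 with hs | hs
  · rw [hb.ratePrim_of_nonpos hs]; positivity
  have h1 : ratePrim b s ≤ ∫ _ in (0 : ℝ)..s, C * s ^ e := by
    refine intervalIntegral.integral_mono_on hs (hb.intervalIntegrable _ _) (by simp)
      fun σ hσ => (h σ hσ.1).trans ?_
    exact mul_le_mul_of_nonneg_left (Real.rpow_le_rpow hσ.1 hσ.2 he.le) hC.le
  rw [intervalIntegral.integral_const, sub_zero, smul_eq_mul] at h1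
  rw [abs_of_nonneg hs, Real.rpow_add_of_nonneg hs zero_le_one he.le, Real.rpow_one]
  linarith

theorem rateEnergy_le (hb : IsSlowRate b e₀) (s : ℝ) :
    rateEnergy b s ≤ Real.arsinh s * ratePrim b s := by
  simpa [rateEnergy, ratePrim] using hb.rateEnergy_sub_le s 0

end IsSlowRate

theorem sublin_ge_of_le_one {s : ℝ} (h0 : 0 ≤ s) (h1 : s ≤ 1) :
    2 ^ (-(1 / 4) : ℝ) * s ≤ sublin s := by
  rw [sublin, mul_comm]
  refine mul_le_mul_of_nonneg_left ?_ h0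
  exact Real.rpow_le_rpow_of_nonpos (by positivity) (by nlinarith) (by norm_num)

theorem sublin_ge_of_one_le {s : ℝ} (h1 : 1 ≤ s) :
    2 ^ (-(1 / 4) : ℝ) * s ^ (1 / 2 : ℝ) ≤ sublin s := by
  have h0 : 0 < s := by linarith
  have : (2 * s ^ 2) ^ (-(1 / 4) : ℝ) ≤ (1 + s ^ 2) ^ (-(1 / 4) : ℝ) :=
    Real.rpow_le_rpow_of_nonpos (by positivity) (by nlinarith) (by norm_num)
  have h2 : s * (s ^ 2) ^ (-(1 / 4) : ℝ) = s ^ (1 / 2 : ℝ) := by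
    rw [← Real.rpow_natCast, ← Real.rpow_mul h0.le]
    nth_rw 1 [← Real.rpow_one s]
    rw [← Real.rpow_add h0]; norm_num
  calc 2 ^ (-(1 / 4) : ℝ) * s ^ (1 / 2 : ℝ) = s * (2 * s ^ 2) ^ (-(1 / 4) : ℝ) := by
        rw [Real.mul_rpow (by norm_num) (by positivity), ← h2]; ring
    _ ≤ sublin s := mul_le_mul_of_nonneg_left this h0.le

theorem IsSlowRate.exists_rateEnergy_le {b : ℝ → ℝ} {e₀ δ : ℝ} (hb : IsSlowRate b e₀)
    (hδ : 0 < δ) (hδe : 4 * δ ≤ e₀) :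
    ∃ C, 0 < C ∧ ∀ s, rateEnergy b s ≤ C * |sublin s| ^ (2 + 4 * δ) := by
  obtain ⟨C1, hC1, h1⟩ := hb.exists_ratePrim_le (e := 4 * δ) (by linarith) hδe
  obtain ⟨C2, hC2, h2⟩ := hb.exists_ratePrim_le hδ (by linarith)
  set κ : ℝ := 2 ^ (-(1 / 4) : ℝ) with hκ
  have hκ0 : 0 < κ := by positivity
  set r : ℝ := 2 + 4 * δ with hr
  refine ⟨(C1 + 3 ^ δ / δ * C2) / κ ^ r, by positivity, fun s => ?_⟩
  rcases le_total s 0 with hs | hs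
  · rw [hb.rateEnergy_of_nonpos hs]; positivity
  have key : ∀ D x, 0 < D → D ≤ C1 + 3 ^ δ / δ * C2 → 0 ≤ x → κ * x ≤ sublin s →
      rateEnergy b s ≤ D * x ^ r →
      rateEnergy b s ≤ (C1 + 3 ^ δ / δ * C2) / κ ^ r * |sublin s| ^ r := by
    intro D x hD0 hD hx hxs hle
    have : κ ^ r * x ^ r ≤ |sublin s| ^ r := by
      rw [← Real.mul_rpow hκ0.le hx]
      exact Real.rpow_le_rpow (by positivity) (hxs.trans (le_abs_self _)) (by positivity)
    calc rateEnergy b s ≤ D * x ^ r := hle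
      _ ≤ (C1 + 3 ^ δ / δ * C2) * x ^ r := by gcongr
      _ = (C1 + 3 ^ δ / δ * C2) / κ ^ r * (κ ^ r * x ^ r) := by field_simp
      _ ≤ _ := by gcongr
  have hB := hb.ratePrim_nonneg s
  rcases le_total s 1 with hs1 | hs1
  · refine key C1 s hC1 (by have : 0 ≤ 3 ^ δ / δ * C2 := by positivity
                            linarith) hs (sublin_ge_of_le_one hs hs1) ?_
    refine (hb.rateEnergy_le s).trans ?_
    have h := h1 s
    rw [abs_of_nonneg hs] at h
    calc Real.arsinh s * ratePrim b s ≤ s * (C1 * s ^ (1 + 4 * δ)) :=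
          mul_le_mul (arsinh_le_self hs) h hB hs
      _ = C1 * s ^ r := by
          have : s ^ r = s * s ^ (1 + 4 * δ) := by
            rw [hr, show 2 + 4 * δ = 1 + (1 + 4 * δ) by ring,
              Real.rpow_add_of_nonneg hs zero_le_one (by linarith), Real.rpow_one]
          rw [this]; ring
  · refine key (3 ^ δ / δ * C2) (s ^ (1 / 2 : ℝ)) (by positivity) (by linarith) (by positivity)
      (sublin_ge_of_one_le hs1) ?_
    refine (hb.rateEnergy_le s).trans ?_
    have h := h2 s
    rw [abs_of_nonneg hs] at h
    calc Real.arsinh s * ratePrim b s ≤ (3 ^ δ / δ * s ^ δ) * (C2 * s ^ (1 + δ)) :=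
          mul_le_mul (arsinh_le_rpow hδ hs1) h hB (by positivity)
      _ = 3 ^ δ / δ * C2 * (s ^ (1 / 2 : ℝ)) ^ r := by
          have : (s ^ (1 / 2 : ℝ)) ^ r = s ^ δ * s ^ (1 + δ) := by
            rw [← Real.rpow_mul hs, ← Real.rpow_add (by linarith)]
            congr 1; rw [hr]; ring
          rw [this]; ring

theorem testPair_add {N : ℕ} {Ω : Opens (Eucl N)} (η ξ : 𝓓(Ω, ℝ)) :
    testPair (η + ξ) = testPair η + testPair ξ := by
  have hg : (fun x => gradient (fun y => (η + ξ) y) x) =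
      (fun x => gradient (fun y => η y) x) + fun x => gradient (fun y => ξ y) x := by
    funext x
    have h1 : DifferentiableAt ℝ (fun y => η y) x := (η.contDiff.differentiable (by simp)) x
    have h2 : DifferentiableAt ℝ (fun y => ξ y) x := (ξ.contDiff.differentiable (by simp)) x
    simp only [gradient, Pi.add_apply, ← map_add]
    congr 1
    exact fderiv_add h1 h2
  unfold testPair
  rw [← WithLp.toLp_add, Prod.mk_add_mk, ← MemLp.toLp_add, ← MemLp.toLp_add]
  congr 2
  exact MemLp.toLp_congr _ _ (by rw [hg])

theorem testPair_smul {N : ℕ} {Ω : Opens (Eucl N)} (c : ℝ) (η : 𝓓(Ω, ℝ)) :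
    testPair (c • η) = c • testPair η := by
  have hg : (fun x => gradient (fun y => (c • η) y) x) =
      c • fun x => gradient (fun y => η y) x := by
    funext x
    have h1 : DifferentiableAt ℝ (fun y => η y) x := (η.contDiff.differentiable (by simp)) x
    simp only [gradient, Pi.smul_apply, ← map_smul]
    congr 1
    exact fderiv_const_smul h1 c
  unfold testPair
  rw [← WithLp.toLp_smul, Prod.smul_mk, ← MemLp.toLp_const_smul, ← MemLp.toLp_const_smul]
  congr 2
  exact MemLp.toLp_congr _ _ (by rw [hg])

theorem span_range_testPair {N : ℕ} (Ω : Opens (Eucl N)) :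
    (Submodule.span ℝ (range (testPair (Ω := Ω))) : Set (L2Pair Ω)) = range testPair := by
  let φ : 𝓓(Ω, ℝ) →ₗ[ℝ] L2Pair Ω :=
    { toFun := testPair, map_add' := testPair_add, map_smul' := testPair_smul }
  have : Submodule.span ℝ (range (testPair (Ω := Ω))) = LinearMap.range φ := by
    rw [← Submodule.span_eq (LinearMap.range φ)]; rfl
  rw [this]; rfl

theorem coe_W012Sub {N : ℕ} (Ω : Opens (Eucl N)) :
    (W012Sub Ω : Set (L2Pair Ω)) = closure (range testPair) := by
  rw [W012Sub, Submodule.topologicalClosure_coe, span_range_testPair]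

namespace W012

variable {N : ℕ} {Ω : Opens (Eucl N)}

theorem denseRange_ofTest : DenseRange (ofTest (Ω := Ω)) := by
  intro w
  have h : w.1 ∈ closure (range (testPair (Ω := Ω))) := by
    rw [← coe_W012Sub]; exact w.2
  have h1 : range (testPair (Ω := Ω)) = Subtype.val '' range (ofTest (Ω := Ω)) :=
    range_comp Subtype.val (ofTest (Ω := Ω))
  rw [h1] at h
  exact closure_subtype.2 h

/-- The underlying function, as a continuous linear map. -/
noncomputable def fnL : W012 Ω →L[ℝ] L2 Ω :=
  (WithLp.fstL 2 ℝ (L2 Ω) (L2Vec Ω)).comp (W012Sub Ω).subtypeL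

/-- The weak gradient, as a continuous linear map. -/
noncomputable def gradL : W012 Ω →L[ℝ] L2Vec Ω :=
  (WithLp.sndL 2 ℝ (L2 Ω) (L2Vec Ω)).comp (W012Sub Ω).subtypeL

theorem fn_ofTest (η : 𝓓(Ω, ℝ)) :
    (ofTest η).fn =ᵐ[volume.restrict (Ω : Set (Eucl N))] fun x => η x :=
  (memLp_test η).coeFn_toLp

theorem grad_ofTest (η : 𝓓(Ω, ℝ)) :
    (ofTest η).grad =ᵐ[volume.restrict (Ω : Set (Eucl N))]
      fun x => gradient (fun y => η y) x :=
  (memLp_gradient_test η).coeFn_toLp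

end W012

theorem enorm_gradient {E : Type*} [NormedAddCommGroup E] [InnerProductSpace ℝ E]
    [CompleteSpace E] (f : E → ℝ) (x : E) : ‖gradient f x‖ₑ = ‖fderiv ℝ f x‖ₑ := by
  simp [gradient, ← ofReal_norm]

theorem eLpNorm_fderiv_restrict {N : ℕ} {Ω : Opens (Eucl N)} (η : 𝓓(Ω, ℝ)) (p : ℝ≥0∞) :
    eLpNorm (fderiv ℝ fun y => η y) p (volume.restrict (Ω : Set (Eucl N))) =
      eLpNorm (fderiv ℝ fun y => η y) p volume := by
  have h : Function.support (fun x => ‖fderiv ℝ (fun y => η y) x‖) ⊆ (Ω : Set (Eucl N)) := by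
    refine subset_trans ?_ ((support_fderiv_subset ℝ).trans η.tsupport_subset)
    intro x hx
    simpa using hx
  rw [← eLpNorm_norm (fderiv ℝ fun y => η y), ← eLpNorm_norm (fderiv ℝ fun y => η y)]
  exact eLpNorm_restrict_eq_of_support_subset h

theorem isFiniteMeasure_restrict_of_isBounded {N : ℕ} {Ω : Opens (Eucl N)}
    (hΩ : Bornology.IsBounded (Ω : Set (Eucl N))) :
    IsFiniteMeasure (volume.restrict (Ω : Set (Eucl N))) :=
  ⟨by rw [Measure.restrict_apply_univ]; exact hΩ.measure_lt_top⟩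

theorem enorm_le_eLpNorm_fderiv_of_finrank_one {Ω : Opens (Eucl 1)} (η : 𝓓(Ω, ℝ)) (x : Eucl 1) :
    ‖η x‖ₑ ≤ eLpNorm (fderiv ℝ fun y => η y) 1 volume := by
  let e : ℝ ≃ₗᵢ[ℝ] Eucl 1 := (OrthonormalBasis.singleton (Fin 1) ℝ).repr
  have hη : ContDiff ℝ 1 fun y => η y := η.contDiff.of_le (by simp)
  have hf : ContDiff ℝ 1 fun s => η (e s) := hη.comp e.contDiff
  have hs : HasCompactSupport fun s => η (e s) :=
    η.hasCompactSupport.comp_homeomorph e.toHomeomorph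
  have h := hs.enorm_le_lintegral_Ici_deriv hf (e.symm x)
  simp only [LinearIsometryEquiv.apply_symm_apply] at h
  refine h.trans ((setLIntegral_le_lintegral _ _).trans ?_)
  rw [eLpNorm_one_eq_lintegral_enorm]
  have hm : MeasurePreserving e := LinearIsometryEquiv.measurePreserving e
  rw [← hm.lintegral_comp (f := fun y => ‖fderiv ℝ (fun y => η y) y‖ₑ)
    (hη.continuous_fderiv (by simp)).enorm.measurable]
  refine lintegral_mono fun s => ?_
  have hd : deriv (fun s => η (e s)) s = fderiv ℝ (fun y => η y) (e s) (e 1) := by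
    have h1 : HasFDerivAt (fun y => η y) (fderiv ℝ (fun y => η y) (e s)) (e s) :=
      (hη.differentiable (by simp) _).hasFDerivAt
    have h2 : HasDerivAt e (e 1) s := e.toContinuousLinearEquiv.toContinuousLinearMap.hasDerivAt
    exact (h1.comp_hasDerivAt s h2).deriv
  rw [hd, ← ofReal_norm, ← ofReal_norm]
  refine ENNReal.ofReal_le_ofReal ((ContinuousLinearMap.le_opNorm _ _).trans ?_)
  simp

/-- The Sobolev inequality for test functions, with an exponent larger than two. -/
theorem exists_sobolev_test {N : ℕ} (hN : 1 ≤ N) {Ω : Opens (Eucl N)}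
    (hΩ : Bornology.IsBounded (Ω : Set (Eucl N))) :
    ∃ (p C : NNReal), 2 < p ∧ ∀ η : 𝓓(Ω, ℝ),
      eLpNorm (fun x => η x) p (volume.restrict (Ω : Set (Eucl N))) ≤
        C * eLpNorm (fderiv ℝ fun y => η y) 2 (volume.restrict (Ω : Set (Eucl N))) := by
  have := isFiniteMeasure_restrict_of_isBounded hΩ
  have haem : ∀ η : 𝓓(Ω, ℝ), Continuous (fderiv ℝ fun y => η y) := fun η =>
    η.contDiff.continuous_fderiv (by simp)
  have hlow : ∀ q : NNReal, 1 ≤ q → q ≤ 2 → ∃ D : NNReal, ∀ η : 𝓓(Ω, ℝ),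
      eLpNorm (fderiv ℝ fun y => η y) q volume ≤
        D * eLpNorm (fderiv ℝ fun y => η y) 2 (volume.restrict (Ω : Set (Eucl N))) := by
    intro q hq1 hq2
    refine ⟨((volume.restrict (Ω : Set (Eucl N))) univ ^
      (1 / (q : ℝ≥0∞).toReal - 1 / (2 : ℝ≥0∞).toReal)).toNNReal, fun η => ?_⟩
    rw [← eLpNorm_fderiv_restrict, ENNReal.coe_toNNReal, mul_comm]
    · exact eLpNorm_le_eLpNorm_mul_rpow_measure_univ (by exact_mod_cast hq2)
        (haem η).aestronglyMeasurable
    · refine ENNReal.rpow_ne_top_of_nonneg ?_ (measure_ne_top _ _)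
      rw [sub_nonneg]
      refine one_div_le_one_div_of_le ?_ ?_
      · simpa using lt_of_lt_of_le one_pos hq1
      · simpa using NNReal.coe_le_coe.2 hq2
  have hsob : ∀ q : NNReal, 1 ≤ q → q ≤ 2 → (q : ℝ) < N → ∀ p : NNReal,
      (q : ℝ)⁻¹ - (N : ℝ)⁻¹ ≤ (p : ℝ)⁻¹ → ∃ C : NNReal, ∀ η : 𝓓(Ω, ℝ),
      eLpNorm (fun x => η x) p (volume.restrict (Ω : Set (Eucl N))) ≤
        C * eLpNorm (fderiv ℝ fun y => η y) 2 (volume.restrict (Ω : Set (Eucl N))) := by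
    intro q hq1 hq2 hqN p hp
    obtain ⟨D, hD⟩ := hlow q hq1 hq2
    refine ⟨eLpNormLESNormFDerivOfLeConst ℝ (volume : Measure (Eucl N)) (Ω : Set (Eucl N)) q p * D,
      fun η => ?_⟩
    have h := eLpNorm_le_eLpNorm_fderiv_of_le (volume : Measure (Eucl N)) (F := ℝ)
      (u := fun x => η x) (s := Ω) (p := q) (q := p) (η.contDiff.of_le (by simp))
      ((subset_tsupport _).trans η.tsupport_subset) hq1
      (by rw [finrank_euclideanSpace_fin]; exact_mod_cast hqN)
      (by rw [finrank_euclideanSpace_fin]; exact hp) hΩ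
    rw [ENNReal.coe_mul, mul_assoc]
    exact (eLpNorm_mono_measure _ Measure.restrict_le_self).trans (h.trans (by gcongr; exact hD η))
  rcases Nat.lt_or_ge 2 N with h3 | h3
  · have hNr : (3 : ℝ) ≤ N := by exact_mod_cast h3
    have hp : (2 : ℝ) < 2 * N / (N - 1) := by
      rw [lt_div_iff₀ (by linarith)]; linarith
    obtain ⟨C, hC⟩ := hsob 2 (by norm_num) le_rfl (by simpa using by linarith)
      (2 * N / (N - 1) : ℝ).toNNReal (by
        have : (N : ℝ) ≠ 0 := by linarith
        rw [Real.coe_toNNReal _ (by linarith), inv_div, NNReal.coe_ofNat, sub_le_iff_le_add]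
        have : (N - 1 : ℝ) / (2 * N) + (N : ℝ)⁻¹ = 2⁻¹ + (2 * N : ℝ)⁻¹ := by
          field_simp; ring
        rw [this]
        have : 0 ≤ (2 * N : ℝ)⁻¹ := by positivity
        linarith)
    exact ⟨_, C, by rwa [← NNReal.coe_lt_coe, Real.coe_toNNReal _ (by linarith)], hC⟩
  · interval_cases N
    · obtain ⟨D, hD⟩ := hlow 1 le_rfl (by norm_num)
      refine ⟨4, D * ((volume.restrict (Ω : Set (Eucl 1))) univ ^
        ((4 : NNReal) : ℝ≥0∞).toReal⁻¹).toNNReal, by norm_num, fun η => ?_⟩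
      refine (eLpNorm_le_of_ae_enorm_bound (Filter.Eventually.of_forall
        (enorm_le_eLpNorm_fderiv_of_finrank_one η))).trans ?_
      rw [ENNReal.coe_mul, ENNReal.coe_toNNReal
        (ENNReal.rpow_ne_top_of_nonneg (by positivity) (measure_ne_top _ _)), smul_eq_mul,
        mul_right_comm]
      gcongr
      exact hD η
    · obtain ⟨C, hC⟩ := hsob (3 / 2) (by
          rw [← NNReal.coe_le_coe]; norm_num) (by rw [← NNReal.coe_le_coe]; norm_num)
        (by norm_num) 4 (by norm_num)
      exact ⟨4, C, by norm_num, hC⟩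

/-- The **Sobolev inequality** in `W₀^{1,2}(Ω)`, for some exponent larger than two. -/
theorem exists_sobolev {N : ℕ} (hN : 1 ≤ N) {Ω : Opens (Eucl N)}
    (hΩ : Bornology.IsBounded (Ω : Set (Eucl N))) :
    ∃ p₀ : ℝ, 2 < p₀ ∧ ∀ r : ℝ, 0 < r → r ≤ p₀ → ∃ C : NNReal, ∀ w : W012 Ω,
      eLpNorm w.fn (ENNReal.ofReal r) (volume.restrict (Ω : Set (Eucl N))) ≤ C * ‖w.grad‖ₑ := by
  have := isFiniteMeasure_restrict_of_isBounded hΩ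
  obtain ⟨p, C, hp, hC⟩ := exists_sobolev_test hN hΩ
  have hbase : ∀ w : W012 Ω,
      eLpNorm w.fn p (volume.restrict (Ω : Set (Eucl N))) ≤ C * ‖w.grad‖ₑ := by
    intro w
    obtain ⟨x, hx, hxw⟩ := mem_closure_iff_seq_limit.1 (W012.denseRange_ofTest w)
    choose η hη using hx
    obtain rfl : x = fun n => W012.ofTest (η n) := funext fun n => (hη n).symm
    have hfn := (W012.fnL.continuous.tendsto w).comp hxw
    have hgrad := ((W012.gradL.continuous.tendsto w).comp hxw).enorm
    refine le_of_forall_gt_imp_ge_of_dense fun a ha => ?_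
    have hev := (ENNReal.Tendsto.const_mul hgrad (Or.inr ENNReal.coe_ne_top)).eventually_lt_const ha
    refine eLpNorm_le_of_tendstoInMeasure (hev.mono fun n hn => ?_)
      (tendstoInMeasure_of_tendsto_Lp hfn) fun n => Lp.aestronglyMeasurable _
    refine le_trans ?_ hn.le
    have h1 : eLpNorm ((W012.ofTest (η n)).fn) p (volume.restrict (Ω : Set (Eucl N))) =
        eLpNorm (fun x => η n x) p (volume.restrict (Ω : Set (Eucl N))) :=
      eLpNorm_congr_ae (W012.fn_ofTest (η n))
    have h2 : ‖(W012.ofTest (η n)).grad‖ₑ =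
        eLpNorm (fderiv ℝ fun y => η n y) 2 (volume.restrict (Ω : Set (Eucl N))) := by
      rw [Lp.enorm_def, eLpNorm_congr_ae (W012.grad_ofTest (η n))]
      exact eLpNorm_congr_enorm_ae (Filter.Eventually.of_forall fun x => enorm_gradient _ x)
    have h3 : eLpNorm ((W012.ofTest (η n)).fn) p (volume.restrict (Ω : Set (Eucl N))) ≤
        C * ‖(W012.ofTest (η n)).grad‖ₑ := by rw [h1, h2]; exact hC (η n)
    exact h3
  refine ⟨p, by exact_mod_cast hp, fun r hr hrp => ?_⟩
  have hrp' : ENNReal.ofReal r ≤ p := ENNReal.ofReal_le_of_le_toReal (by simpa using hrp)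
  have hexp : 0 ≤ 1 / (ENNReal.ofReal r).toReal - 1 / (p : ℝ≥0∞).toReal := by
    rw [sub_nonneg, ENNReal.toReal_ofReal hr.le]
    exact one_div_le_one_div_of_le hr (by simpa using hrp)
  refine ⟨C * ((volume.restrict (Ω : Set (Eucl N))) univ ^
    (1 / (ENNReal.ofReal r).toReal - 1 / (p : ℝ≥0∞).toReal)).toNNReal, fun w => ?_⟩
  rw [ENNReal.coe_mul, ENNReal.coe_toNNReal
    (ENNReal.rpow_ne_top_of_nonneg hexp (measure_ne_top _ _)), mul_right_comm]
  refine (eLpNorm_le_eLpNorm_mul_rpow_measure_univ hrp' (Lp.aestronglyMeasurable _)).trans ?_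
  gcongr
  exact hbase w

open Filter Topology in
/-- Dominated convergence in `L²`, for multiplication by a uniformly bounded sequence. -/
theorem tendsto_eLpNorm_smul_of_ae_tendsto_zero {α E : Type*} {mα : MeasurableSpace α}
    {μ : Measure α} [NormedAddCommGroup E] [NormedSpace ℝ E] {φ : ℕ → α → ℝ} {G : α → E}
    {K : ℝ} (hφm : ∀ n, AEStronglyMeasurable (φ n) μ) (hG : MemLp G 2 μ)
    (hK : ∀ n x, |φ n x| ≤ K)
    (hφ : ∀ᵐ x ∂μ, Tendsto (fun n => φ n x) atTop (𝓝 0)) :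
    Tendsto (fun n => eLpNorm (fun x => φ n x • G x) 2 μ) atTop (𝓝 0) := by
  have h2 : ∀ f : α → E, eLpNorm f 2 μ = (∫⁻ x, ‖f x‖ₑ ^ (2 : ℝ) ∂μ) ^ (1 / 2 : ℝ) := fun f => by
    rw [eLpNorm_eq_lintegral_rpow_enorm_toReal (by norm_num) (by norm_num)]; simp
  simp only [h2]
  have hlim : Tendsto (fun n => ∫⁻ x, ‖φ n x • G x‖ₑ ^ (2 : ℝ) ∂μ) atTop
      (𝓝 (∫⁻ _, 0 ∂μ)) := by
    refine tendsto_lintegral_of_dominated_convergence'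
      (fun x => (ENNReal.ofReal K * ‖G x‖ₑ) ^ (2 : ℝ))
      (fun n => ((hφm n).smul hG.1).enorm.pow_const _) (fun n => ?_) ?_ ?_
    · refine Eventually.of_forall fun x => ?_
      simp only
      gcongr
      rw [enorm_smul]
      gcongr
      rw [← ofReal_norm]
      exact ENNReal.ofReal_le_ofReal (hK n x)
    · simp_rw [ENNReal.mul_rpow_of_nonneg _ _ (zero_le_two (α := ℝ))]
      rw [lintegral_const_mul'' _ (hG.1.enorm.pow_const _)]
      refine ENNReal.mul_ne_top (by finiteness) ?_
      have := hG.2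
      rw [h2] at this
      intro htop
      rw [htop] at this
      simp at this
    · filter_upwards [hφ] with x hx
      have h := ((hx.smul_const (G x)).enorm).ennrpow_const (2 : ℝ)
      simpa using h
  have := hlim.ennrpow_const (1 / 2 : ℝ)
  simpa using this

section GradComp

variable {α E : Type*} {mα : MeasurableSpace α} {μ : Measure α} [NormedAddCommGroup E]
  [NormedSpace ℝ E]

theorem memLp_comp_smul {φ : ℝ → ℝ} {K : ℝ} (hφ : Continuous φ) (hK : ∀ s, |φ s| ≤ K)
    (f : Lp ℝ 2 μ) (G : Lp E 2 μ) : MemLp (fun x => φ (f x) • G x) 2 μ := by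
  refine (Lp.memLp G).of_le_mul (c := K)
    ((hφ.comp_aestronglyMeasurable (Lp.aestronglyMeasurable f)).smul (Lp.aestronglyMeasurable G))
    (Filter.Eventually.of_forall fun x => ?_)
  rw [norm_smul]
  exact mul_le_mul_of_nonneg_right (hK _) (norm_nonneg _)

open Filter Topology in
theorem continuous_comp_smul [Fact ((1 : ℝ≥0∞) ≤ 2)] {φ : ℝ → ℝ} {K : ℝ} (hφ : Continuous φ)
    (hK : ∀ s, |φ s| ≤ K) :
    Continuous fun p : Lp ℝ 2 μ × Lp E 2 μ => (memLp_comp_smul hφ hK p.1 p.2).toLp _ := by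
  refine continuous_iff_seqContinuous.2 fun p q hpq => ?_
  refine tendsto_of_subseq_tendsto fun ns hns => ?_
  have h1 : Tendsto (fun n => (p (ns n)).1) atTop (𝓝 q.1) :=
    (continuous_fst.tendsto q).comp (hpq.comp hns)
  have h2 : Tendsto (fun n => (p (ns n)).2) atTop (𝓝 q.2) :=
    (continuous_snd.tendsto q).comp (hpq.comp hns)
  obtain ⟨ms, hms, hae⟩ := (tendstoInMeasure_of_tendsto_Lp h1).exists_seq_tendsto_ae
  refine ⟨ms, ?_⟩
  have h2' := h2.comp hms.tendsto_atTop
  rw [Lp.tendsto_Lp_iff_tendsto_eLpNorm'] at h2' ⊢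
  have hA : Tendsto (fun n => eLpNorm
      (fun x => (φ ((p (ns (ms n))).1 x) - φ (q.1 x)) • q.2 x) 2 μ) atTop (𝓝 0) := by
    refine tendsto_eLpNorm_smul_of_ae_tendsto_zero (K := 2 * K) (fun n => ?_) (Lp.memLp q.2)
      (fun n x => ?_) ?_
    · exact (hφ.comp_aestronglyMeasurable (Lp.aestronglyMeasurable _)).sub
        (hφ.comp_aestronglyMeasurable (Lp.aestronglyMeasurable _))
    · have := abs_sub (φ ((p (ns (ms n))).1 x)) (φ (q.1 x))
      linarith [hK ((p (ns (ms n))).1 x), hK (q.1 x)]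
    · filter_upwards [hae] with x hx
      simpa using ((hφ.tendsto _).comp hx).sub_const (φ (q.1 x))
  have hB := ENNReal.Tendsto.const_mul (a := ENNReal.ofReal K) h2' (Or.inr ENNReal.ofReal_ne_top)
  rw [mul_zero] at hB
  have hAB := hB.add hA
  rw [zero_add] at hAB
  refine tendsto_of_tendsto_of_tendsto_of_le_of_le tendsto_const_nhds hAB (fun _ => zero_le) fun n => ?_
  set P := p (ns (ms n)) with hP
  have hm1 : AEStronglyMeasurable (fun x => φ (P.1 x) • (P.2 x - q.2 x)) μ :=
    (hφ.comp_aestronglyMeasurable (Lp.aestronglyMeasurable _)).smul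
      ((Lp.aestronglyMeasurable _).sub (Lp.aestronglyMeasurable _))
  have hm2 : AEStronglyMeasurable (fun x => (φ (P.1 x) - φ (q.1 x)) • q.2 x) μ :=
    ((hφ.comp_aestronglyMeasurable (Lp.aestronglyMeasurable _)).sub
      (hφ.comp_aestronglyMeasurable (Lp.aestronglyMeasurable _))).smul (Lp.aestronglyMeasurable _)
  calc _ = eLpNorm ((fun x => φ (P.1 x) • (P.2 x - q.2 x)) +
        fun x => (φ (P.1 x) - φ (q.1 x)) • q.2 x) 2 μ := by
        refine eLpNorm_congr_ae ?_
        filter_upwards [(memLp_comp_smul hφ hK P.1 P.2).coeFn_toLp,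
          (memLp_comp_smul hφ hK q.1 q.2).coeFn_toLp] with x hx1 hx2
        simp only [Pi.sub_apply, Pi.add_apply, Function.comp, ← hP]
        rw [hx1, hx2, smul_sub, sub_smul]; abel
    _ ≤ _ := (eLpNorm_add_le hm1 hm2 (by norm_num)).trans ?_
  refine add_le_add ?_ le_rfl
  refine (eLpNorm_le_mul_eLpNorm_of_ae_le_mul (g := ⇑P.2 - ⇑q.2) (c := K)
    (Eventually.of_forall fun x => ?_) 2).trans le_rfl
  rw [norm_smul]
  exact mul_le_mul_of_nonneg_right (hK _) (norm_nonneg _)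

end GradComp

/-- Composition of a test function with a smooth function vanishing at zero. -/
noncomputable def compTest {N : ℕ} {Ω : Opens (Eucl N)} {f : ℝ → ℝ} (hf : ContDiff ℝ ∞ f)
    (h0 : f 0 = 0) (η : 𝓓(Ω, ℝ)) : 𝓓(Ω, ℝ) where
  toFun x := f (η x)
  contDiff' := hf.comp η.contDiff
  hasCompactSupport' := η.hasCompactSupport.comp_left h0
  tsupport_subset' :=
    (closure_mono (Function.support_comp_subset h0 (fun x => η x))).trans η.tsupport_subset

/-- The chain rule in `W₀^{1,2}(Ω)`: composition with a smooth function vanishing at zero and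
having a bounded derivative. -/
theorem exists_comp {N : ℕ} (Ω : Opens (Eucl N)) {f : ℝ → ℝ} (hf : ContDiff ℝ ∞ f)
    (h0 : f 0 = 0) {K : NNReal} (hK : ∀ s, |deriv f s| ≤ K) :
    ∃ Φ : W012 Ω → W012 Ω, Continuous Φ ∧ ∀ w : W012 Ω,
      ((Φ w).fn =ᵐ[volume.restrict (Ω : Set (Eucl N))] fun x => f (w.fn x)) ∧
      ((Φ w).grad =ᵐ[volume.restrict (Ω : Set (Eucl N))]
        fun x => deriv f (w.fn x) • w.grad x) := by
  have hd : Continuous (deriv f) := hf.continuous_deriv (by simp)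
  have hdiff : Differentiable ℝ f := hf.differentiable (by simp)
  have hlip : LipschitzWith K f :=
    lipschitzWith_of_nnnorm_deriv_le hdiff fun s => by
      rw [← NNReal.coe_le_coe, coe_nnnorm]; exact hK s
  let Ψ : L2Pair Ω → L2Pair Ω := fun p =>
    WithLp.toLp 2 (hlip.compLp h0 p.fst, (memLp_comp_smul hd hK p.fst p.snd).toLp _)
  have hΨ : Continuous Ψ := by
    have hfst : Continuous fun p : L2Pair Ω => p.fst :=
      (WithLp.fstL 2 ℝ (L2 Ω) (L2Vec Ω)).continuous
    have hsnd : Continuous fun p : L2Pair Ω => p.snd :=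
      (WithLp.sndL 2 ℝ (L2 Ω) (L2Vec Ω)).continuous
    exact (WithLp.prod_continuous_toLp 2 _ _).comp
      (((hlip.continuous_compLp h0).comp hfst).prodMk
        ((continuous_comp_smul hd hK).comp (hfst.prodMk hsnd)))
  have htest : ∀ η : 𝓓(Ω, ℝ), Ψ (testPair η) = testPair (compTest hf h0 η) := by
    intro η
    refine congrArg (WithLp.toLp 2) (Prod.ext ?_ ?_)
    · refine Lp.ext ?_
      filter_upwards [hlip.coeFn_compLp h0 (testPair η).fst, (memLp_test η).coeFn_toLp,
        (memLp_test (compTest hf h0 η)).coeFn_toLp] with x h1 h2 h3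
      rw [h1, h3]
      exact congrArg f h2
    · refine Lp.ext ?_
      filter_upwards [(memLp_comp_smul hd hK (testPair η).fst (testPair η).snd).coeFn_toLp,
        (memLp_test η).coeFn_toLp, (memLp_gradient_test η).coeFn_toLp,
        (memLp_gradient_test (compTest hf h0 η)).coeFn_toLp] with x h1 h2 h3 h4
      rw [h1, h4]
      have e2 : (testPair η).fst x = η x := h2
      have e3 : (testPair η).snd x = gradient (fun y => η y) x := h3
      have hη : DifferentiableAt ℝ (fun y => η y) x := (η.contDiff.differentiable (by simp)) x
      rw [e2, e3]
      change _ = gradient (fun y => f (η y)) x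
      unfold gradient
      rw [← map_smul]
      congr 1
      have := (hdiff (η x)).hasDerivAt.comp_hasFDerivAt x hη.hasFDerivAt
      exact this.fderiv.symm
  have hmaps : ∀ p ∈ W012Sub Ω, Ψ p ∈ W012Sub Ω := by
    intro p hp
    have hp' : p ∈ closure (range (testPair (Ω := Ω))) := by rw [← coe_W012Sub]; exact hp
    have h1 : Ψ p ∈ closure (range (testPair (Ω := Ω))) := by
      refine map_mem_closure hΨ hp' ?_
      rintro _ ⟨η, rfl⟩
      exact ⟨_, (htest η).symm⟩
    rw [← coe_W012Sub] at h1
    exact h1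
  refine ⟨fun w => ⟨Ψ w.1, hmaps _ w.2⟩, ?_, fun w => ⟨?_, ?_⟩⟩
  · exact (hΨ.comp continuous_subtype_val).subtype_mk _
  · exact hlip.coeFn_compLp h0 _
  · exact (memLp_comp_smul hd hK _ _).coeFn_toLp

/-- A compactly supported smooth function with integral zero has a compactly supported primitive,
with support in the same interval. -/
theorem exists_testFunction_deriv_eq {T : ℝ} (hT : 0 < T) {ζ : ℝ → ℝ} (hζ : ContDiff ℝ ∞ ζ)
    (hc : HasCompactSupport ζ) (hs : tsupport ζ ⊆ Ioo 0 T) (h0 : ∫ t, ζ t = 0) :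
    ∃ ψ : 𝓓((⟨Ioo 0 T, isOpen_Ioo⟩ : Opens ℝ), ℝ), deriv (fun t => ψ t) = ζ := by
  set K := insert (T / 2) (tsupport ζ) with hK
  have hKc : IsCompact K := IsCompact.insert hc _
  have hKne : K.Nonempty := ⟨_, mem_insert _ _⟩
  have hKs : K ⊆ Ioo 0 T := insert_subset ⟨by linarith, by linarith⟩ hs
  have hα := hKs (hKc.sInf_mem hKne)
  have hβ := hKs (hKc.sSup_mem hKne)
  have hsub : ∀ t, ζ t ≠ 0 → t ∈ Icc (sInf K) (sSup K) := fun t ht =>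
    have : t ∈ K := Or.inr (subset_tsupport _ ht)
    ⟨csInf_le hKc.bddBelow this, le_csSup hKc.bddAbove this⟩
  have hd : ∀ t, HasDerivAt (fun t => ∫ τ in (0 : ℝ)..t, ζ τ) (ζ t) t := fun t =>
    (hζ.continuous.integral_hasStrictDerivAt 0 t).hasDerivAt
  have hsupp : tsupport (fun t => ∫ τ in (0 : ℝ)..t, ζ τ) ⊆ Icc (sInf K) (sSup K) := by
    refine closure_minimal (fun t ht => ?_) isClosed_Icc
    by_contra hcon
    refine ht ?_
    rw [mem_Icc, not_and_or, not_le, not_le] at hcon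
    rcases hcon with h | h
    · refine (intervalIntegral.integral_congr (g := fun _ => 0) fun τ hτ => ?_).trans (by simp)
      by_contra hne
      have h1 := (hsub τ hne).1
      have h2 : τ ≤ max 0 t := hτ.2
      exact absurd (h1.trans h2) (not_le.2 (max_lt hα.1 h))
    · change ∫ τ in (0 : ℝ)..t, ζ τ = 0
      rw [intervalIntegral.integral_eq_integral_of_support_subset, h0]
      intro τ hτ
      exact ⟨hα.1.trans_le (hsub τ hτ).1, (hsub τ hτ).2.trans h.le⟩
  have hderiv : deriv (fun t => ∫ τ in (0 : ℝ)..t, ζ τ) = ζ := funext fun t => (hd t).deriv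
  refine ⟨⟨fun t => ∫ τ in (0 : ℝ)..t, ζ τ, ?_, ?_, ?_⟩, hderiv⟩
  · exact contDiff_infty_iff_deriv.2 ⟨fun t => (hd t).differentiableAt, by rwa [hderiv]⟩
  · exact isCompact_Icc.of_isClosed_subset (isClosed_tsupport _) hsupp
  · exact hsupp.trans (Icc_subset_Ioo hα.1 hβ.2)

/-- The **du Bois-Reymond lemma** on an interval. -/
theorem eq_const_of_integral_deriv_mul_eq_zero {T : ℝ} (hT : 0 < T) {C : ℝ → ℝ}
    (hC : ContinuousOn C (Icc 0 T))
    (h : ∀ ψ : 𝓓((⟨Ioo 0 T, isOpen_Ioo⟩ : Opens ℝ), ℝ),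
      ∫ t in Ioo 0 T, deriv (fun s => ψ s) t * C t = 0) :
    ∃ c, ∀ t ∈ Icc 0 T, C t = c := by
  obtain ⟨ρ, hρs, hρc, hρd, hρ0, hρ1⟩ := exists_contDiff_tsupport_subset (n := (⊤ : ℕ∞))
    (isOpen_Ioo.mem_nhds (⟨by linarith, by linarith⟩ : T / 2 ∈ Ioo 0 T))
  have hρpos : 0 < ∫ t, ρ t :=
    hρd.continuous.integral_pos_of_hasCompactSupport_nonneg_nonzero hρc
      (fun t => (hρ0 (mem_range_self t)).1) (x := T / 2) (by rw [hρ1]; exact one_ne_zero)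
  have hout : ∀ {χ : ℝ → ℝ}, tsupport χ ⊆ Ioo 0 T → ∀ t, t ∉ Ioo 0 T → χ t = 0 :=
    fun hχ t ht => by
      by_contra hne
      exact ht (hχ (subset_tsupport _ hne))
  have hint : ∀ {χ : ℝ → ℝ}, Continuous χ →
      IntegrableOn (fun t => χ t * C t) (Ioo 0 T) := fun hχ =>
    ((hχ.continuousOn.mul hC).integrableOn_compact isCompact_Icc).mono_set Ioo_subset_Icc_self
  set c := (∫ t in Ioo 0 T, ρ t * C t) / ∫ t, ρ t with hc
  have hae := isOpen_Ioo.ae_eq_zero_of_integral_contDiff_smul_eq_zero (μ := volume)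
    (U := Ioo 0 T) (f := fun t => C t - c)
    (((hC.mono Ioo_subset_Icc_self).sub continuousOn_const).locallyIntegrableOn
      measurableSet_Ioo) fun χ hχd hχc hχs => by
    have hζd : ContDiff ℝ ∞ (fun t => χ t - (∫ t, χ t) / (∫ t, ρ t) * ρ t) :=
      hχd.sub (contDiff_const.mul hρd)
    have hζs : tsupport (fun t => χ t - (∫ t, χ t) / (∫ t, ρ t) * ρ t) ⊆
        tsupport χ ∪ tsupport ρ := by
      refine closure_minimal (fun t ht => ?_) ((isClosed_tsupport _).union (isClosed_tsupport _))
      by_contra hcon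
      rw [mem_union, not_or] at hcon
      refine ht ?_
      simp only [image_eq_zero_of_notMem_tsupport hcon.1, image_eq_zero_of_notMem_tsupport hcon.2]
      ring
    have hχi : Integrable χ := hχd.continuous.integrable_of_hasCompactSupport hχc
    have hρi : Integrable ρ := hρd.continuous.integrable_of_hasCompactSupport hρc
    obtain ⟨ψ, hψ⟩ := exists_testFunction_deriv_eq hT hζd
      ((hχc.isCompact.union hρc.isCompact).of_isClosed_subset (isClosed_tsupport _) hζs)
      (hζs.trans (union_subset hχs hρs)) (by
        rw [integral_sub hχi (hρi.const_mul _), integral_const_mul]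
        field_simp
        ring)
    have h1 := h ψ
    simp only [hψ, sub_mul, mul_assoc] at h1
    rw [integral_sub (hint hχd.continuous) ((hint hρd.continuous).const_mul _),
      integral_const_mul] at h1
    have h2 : ∫ t, χ t • (C t - c) = ∫ t in Ioo 0 T, χ t • (C t - c) := by
      refine (setIntegral_eq_integral_of_forall_compl_eq_zero fun t ht => ?_).symm
      rw [hout hχs t ht, zero_smul]
    have h3 : ∫ t, χ t = ∫ t in Ioo 0 T, χ t :=
      (setIntegral_eq_integral_of_forall_compl_eq_zero fun t ht => hout hχs t ht).symm
    rw [h2]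
    simp only [smul_eq_mul, mul_sub]
    rw [integral_sub (hint hχd.continuous) (hχi.integrableOn.mul_const _), integral_mul_const,
      ← h3, hc]
    refine Eq.trans ?_ h1
    ring
  refine ⟨c, fun t ht => ?_⟩
  have heq : EqOn C (fun _ => c) (Ioo 0 T) := by
    have h1 : C =ᵐ[volume.restrict (Ioo 0 T)] fun _ => c := by
      rw [Filter.EventuallyEq, ae_restrict_iff' measurableSet_Ioo]
      filter_upwards [hae] with x hx hx'
      linarith [hx hx']
    exact Measure.eqOn_open_of_ae_eq h1 isOpen_Ioo (hC.mono Ioo_subset_Icc_self)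
      continuousOn_const
  refine heq.of_subset_closure hC continuousOn_const Ioo_subset_Icc_self ?_ ht
  rw [closure_Ioo hT.ne]

/-- A continuous function whose weak derivative is integrable is its primitive. -/
theorem sub_eq_neg_integral_of_weakDeriv {T : ℝ} (hT : 0 < T) {B a : ℝ → ℝ}
    (hB : ContinuousOn B (Icc 0 T)) (ha : IntegrableOn a (Ioo 0 T))
    (h : ∀ ψ : 𝓓((⟨Ioo 0 T, isOpen_Ioo⟩ : Opens ℝ), ℝ),
      ∫ t in Ioo 0 T, deriv (fun s => ψ s) t * B t = ∫ t in Ioo 0 T, ψ t * a t)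
    {s t : ℝ} (hs : 0 ≤ s) (hst : s ≤ t) (ht : t ≤ T) :
    B t - B s = -∫ τ in s..t, a τ := by
  have hai : IntervalIntegrable a volume 0 T := by
    rw [intervalIntegrable_iff_integrableOn_Ioo_of_le hT.le]; exact ha
  set A : ℝ → ℝ := fun t => ∫ τ in (0 : ℝ)..t, a τ with hA
  have hAac : AbsolutelyContinuousOnInterval A 0 T :=
    hai.absolutelyContinuousOnInterval_intervalIntegral (by simp)
  have hAc : ContinuousOn A (Icc 0 T) := by
    have := hAac.continuousOn; rwa [uIcc_of_le hT.le] at this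
  have hAd : ∀ᵐ x, x ∈ Ioo 0 T → deriv A x = a x := by
    filter_upwards [hai.ae_hasDerivAt_integral] with x hx hx'
    rw [uIcc_of_le hT.le] at hx
    exact (hx (Ioo_subset_Icc_self hx') 0 ⟨le_rfl, hT.le⟩).deriv
  obtain ⟨c, hc⟩ := eq_const_of_integral_deriv_mul_eq_zero hT (hB.add hAc) fun ψ => by
    have hψd : ContDiff ℝ 1 fun s => ψ s := ψ.contDiff.of_le (by simp)
    have hψ' : Continuous (deriv fun s => ψ s) := hψd.continuous_deriv le_rfl
    have hψac : AbsolutelyContinuousOnInterval (fun s => ψ s) 0 T :=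
      hψd.contDiffOn.absolutelyContinuousOnInterval
    have hψ0 : ∀ t, t ∉ Ioo 0 T → ψ t = 0 := fun t ht => by
      by_contra hne
      exact ht (ψ.tsupport_subset (subset_tsupport _ hne))
    have hparts := hAac.integral_mul_deriv_eq_deriv_mul hψac
    simp only [hψ0 0 (by simp), hψ0 T (by simp), mul_zero, sub_zero, zero_sub] at hparts
    rw [intervalIntegral.integral_of_le hT.le, intervalIntegral.integral_of_le hT.le,
      integral_Ioc_eq_integral_Ioo, integral_Ioc_eq_integral_Ioo] at hparts
    have hint : ∀ f : ℝ → ℝ, ContinuousOn f (Icc 0 T) →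
        IntegrableOn (fun t => deriv (fun s => ψ s) t * f t) (Ioo 0 T) := fun f hf =>
      ((hψ'.continuousOn.mul hf).integrableOn_compact isCompact_Icc).mono_set Ioo_subset_Icc_self
    simp only [Pi.add_apply, mul_add]
    rw [integral_add (hint B hB) (hint A hAc), h ψ]
    have e1 : ∫ t in Ioo 0 T, deriv (fun s => ψ s) t * A t =
        ∫ t in Ioo 0 T, A t * deriv (fun s => ψ s) t := by simp_rw [mul_comm]
    have e2 : ∫ t in Ioo 0 T, deriv A t * ψ t = ∫ t in Ioo 0 T, ψ t * a t := by
      refine setIntegral_congr_ae measurableSet_Ioo ?_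
      filter_upwards [hAd] with x hx hx'
      rw [hx hx', mul_comm]
    rw [e1, hparts, e2, add_neg_cancel]
  have h1 := hc s ⟨hs, hst.trans ht⟩
  have h2 := hc t ⟨hs.trans hst, ht⟩
  simp only [Pi.add_apply] at h1 h2
  have h3 : A t - A s = ∫ τ in s..t, a τ := by
    refine intervalIntegral.integral_interval_sub_left ?_ ?_ <;>
    refine hai.mono_set ?_ <;> rw [uIcc_of_le (by linarith), uIcc_of_le hT.le] <;>
    refine Icc_subset_Icc le_rfl (by linarith)
  linarith

/-- Finite-time extinction for `y' ≤ -c y ^ a`, `0 < a < 1`, in integrated form. -/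
theorem eq_zero_of_integral_ineq {T a c : ℝ} (ha0 : 0 < a) (ha1 : a < 1) (hc : 0 < c)
    {y : ℝ → ℝ} (hy : ContinuousOn y (Icc 0 T)) (hy0 : ∀ t ∈ Icc 0 T, 0 ≤ y t)
    (h : ∀ s t, 0 ≤ s → s ≤ t → t ≤ T → y t - y s ≤ -(c * ∫ τ in s..t, y τ ^ a))
    {t : ℝ} (ht0 : 0 ≤ t) (ht : y 0 ^ (1 - a) / ((1 - a) * c) < t) (htT : t ≤ T) : y t = 0 := by
  have h1a : 0 < 1 - a := by linarith
  by_contra hne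
  have hyt : 0 < y t := (hy0 t ⟨ht0, htT⟩).lt_of_ne' hne
  have hT : 0 ≤ T := ht0.trans htT
  set Y : ℝ → ℝ := IccExtend hT ((Icc 0 T).domRestrict y) with hY
  have hYc : Continuous Y := (continuousOn_iff_continuous_domRestrict.1 hy).Icc_extend'
  have hYy : ∀ s ∈ Icc 0 T, Y s = y s := fun s hs => IccExtend_of_mem hT _ hs
  have hYa : Continuous fun s => Y s ^ a := hYc.rpow_const fun _ => Or.inr ha0.le
  set Z : ℝ → ℝ := fun s => y t + c * ∫ τ in s..t, Y τ ^ a with hZ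
  have hZd : ∀ s, HasDerivAt Z (-(c * Y s ^ a)) s := fun s => by
    have h1 : HasDerivAt (fun s => ∫ τ in s..t, Y τ ^ a) (-(Y s ^ a)) s :=
      intervalIntegral.integral_hasDerivAt_left (hYa.intervalIntegrable _ _)
        (hYa.stronglyMeasurableAtFilter _ _) hYa.continuousAt
    have := (h1.const_mul c).const_add (y t)
    rwa [mul_neg] at this
  have hZle : ∀ s ∈ Icc 0 t, Z s ≤ Y s := fun s hs => by
    have h1 := h s t hs.1 hs.2 htT
    have h2 : ∫ τ in s..t, y τ ^ a = ∫ τ in s..t, Y τ ^ a := by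
      refine intervalIntegral.integral_congr fun τ hτ => ?_
      rw [uIcc_of_le hs.2] at hτ
      rw [hYy τ ⟨hs.1.trans hτ.1, hτ.2.trans htT⟩]
    rw [hYy s ⟨hs.1, hs.2.trans htT⟩]
    simp only [hZ, ← h2]
    linarith
  have hZpos : ∀ s ∈ Icc 0 t, 0 < Z s := fun s hs => by
    have : 0 ≤ ∫ τ in s..t, Y τ ^ a := by
      refine intervalIntegral.integral_nonneg hs.2 fun τ hτ => Real.rpow_nonneg ?_ _
      have : τ ∈ Icc 0 T := ⟨hs.1.trans hτ.1, hτ.2.trans htT⟩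
      rw [hYy τ this]
      exact hy0 τ this
    simp only [hZ]
    positivity
  have hWd : ∀ s ∈ Icc 0 t, HasDerivAt (fun s => Z s ^ (1 - a) + (1 - a) * c * s)
      (-(c * Y s ^ a) * (1 - a) * Z s ^ (1 - a - 1) + (1 - a) * c * 1) s := fun s hs =>
    ((hZd s).rpow_const (Or.inl (hZpos s hs).ne')).add ((hasDerivAt_id s).const_mul _)
  have hanti : AntitoneOn (fun s => Z s ^ (1 - a) + (1 - a) * c * s) (Icc 0 t) := by
    refine antitoneOn_of_deriv_nonpos (convex_Icc 0 t)
      (fun s hs => (hWd s hs).continuousAt.continuousWithinAt)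
      (fun s hs => (hWd s (interior_subset hs)).differentiableAt.differentiableWithinAt)
      fun s hs => ?_
    have hs' := interior_subset hs
    rw [(hWd s hs').deriv]
    have hZs := hZpos s hs'
    have h1 : 1 ≤ Y s ^ a * Z s ^ (1 - a - 1) := by
      calc (1 : ℝ) = Z s ^ a * Z s ^ (1 - a - 1) := by
            rw [← Real.rpow_add hZs]; simp
        _ ≤ _ := by
            gcongr
            exact hZle s hs'
    have : 0 < (1 - a) * c := by positivity
    nlinarith
  have h2 := hanti ⟨le_rfl, ht0⟩ ⟨ht0, le_rfl⟩ ht0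
  simp only [mul_zero, add_zero] at h2
  have h3 : Z 0 ^ (1 - a) ≤ y 0 ^ (1 - a) := by
    refine Real.rpow_le_rpow (hZpos 0 ⟨le_rfl, ht0⟩).le ?_ h1a.le
    rw [← hYy 0 ⟨le_rfl, hT⟩]
    exact hZle 0 ⟨le_rfl, ht0⟩
  have h4 : 0 < Z t ^ (1 - a) := Real.rpow_pos_of_pos (hZpos t ⟨ht0, le_rfl⟩) _
  rw [div_lt_iff₀ (by positivity)] at ht
  nlinarith

section Averages

open Filter Topology

theorem memLp_comp_sub_right {E : Type*} [NormedAddCommGroup E] {V : ℝ → E}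
    (hV : MemLp V 2 volume) (σ : ℝ) : MemLp (fun t => V (t - σ)) 2 volume :=
  hV.comp_measurePreserving (measurePreserving_sub_right volume σ)

variable {E : Type*} [NormedAddCommGroup E] [InnerProductSpace ℝ E]

theorem integrable_inner_of_memLp {α : Type*} {mα : MeasurableSpace α} {μ : Measure α}
    {V Φ : α → E} (hV : MemLp V 2 μ) (hΦ : MemLp Φ 2 μ) :
    Integrable (fun t => inner ℝ (V t) (Φ t)) μ := by
  refine (L2.integrable_inner (𝕜 := ℝ) (hV.toLp V) (hΦ.toLp Φ)).congr ?_
  filter_upwards [hV.coeFn_toLp, hΦ.coeFn_toLp] with t h1 h2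
  rw [h1, h2]

theorem integral_inner_comp_sub_eq {V Φ : ℝ → E} (hV : MemLp V 2 volume)
    (hΦ : MemLp Φ 2 volume) (σ : ℝ) :
    ∫ t, inner ℝ (V (t - σ)) (Φ t) =
      inner ℝ (Lp.compMeasurePreserving (fun t => t - σ) (measurePreserving_sub_right volume σ)
        (hV.toLp V)) (hΦ.toLp Φ) := by
  rw [L2.inner_def]
  refine integral_congr_ae ?_
  have h1 : (fun t => hV.toLp V (t - σ)) =ᵐ[volume] fun t => V (t - σ) :=
    (measurePreserving_sub_right volume σ).quasiMeasurePreserving.ae_eq_comp hV.coeFn_toLp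
  filter_upwards [Lp.coeFn_compMeasurePreserving (hV.toLp V)
    (measurePreserving_sub_right volume σ), h1, hΦ.coeFn_toLp] with t h2 h3 h4
  rw [h2, h4]
  exact congrArg (fun z => inner ℝ z (Φ t)) h3.symm

theorem continuous_integral_inner_comp_sub {V Φ : ℝ → E} (hV : MemLp V 2 volume)
    (hΦ : MemLp Φ 2 volume) :
    Continuous fun σ : ℝ => ∫ t, inner ℝ (V (t - σ)) (Φ t) := by
  simp_rw [integral_inner_comp_sub_eq hV hΦ]
  refine Continuous.inner ?_ continuous_const
  let g : C(ℝ, C(ℝ, ℝ)) := (ContinuousMap.mk (fun a : ℝ × ℝ => a.2 - a.1) (by fun_prop)).curry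
  exact (continuous_const (y := hV.toLp V)).compMeasurePreservingLp g.continuous
    (fun σ => measurePreserving_sub_right volume σ) (by norm_num)

theorem integral_norm_inner_comp_sub_le {V Φ : ℝ → E} (hV : MemLp V 2 volume)
    (hΦ : MemLp Φ 2 volume) (σ : ℝ) :
    ∫ t, ‖inner ℝ (V (t - σ)) (Φ t)‖ ≤ (∫ t, ‖V t‖ ^ 2) + ∫ t, ‖Φ t‖ ^ 2 := by
  have hVσ := memLp_comp_sub_right hV σ
  have h1 : Integrable fun t => ‖V (t - σ)‖ ^ 2 := hVσ.integrable_norm_pow (by norm_num)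
  have h2 : Integrable fun t => ‖Φ t‖ ^ 2 := hΦ.integrable_norm_pow (by norm_num)
  rw [← integral_sub_right_eq_self (fun t => ‖V t‖ ^ 2) σ, ← integral_add h1 h2]
  refine integral_mono_of_nonneg (Eventually.of_forall fun t => norm_nonneg _) (h1.add h2)
    (Eventually.of_forall fun t => ?_)
  have := norm_inner_le_norm (𝕜 := ℝ) (V (t - σ)) (Φ t)
  simp only
  nlinarith [sq_nonneg (‖V (t - σ)‖ - ‖Φ t‖), norm_nonneg (V (t - σ)), norm_nonneg (Φ t)]

variable [CompleteSpace E]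

theorem integral_inner_average {V Φ : ℝ → E} (hV : MemLp V 2 volume) (hΦ : MemLp Φ 2 volume)
    {h : ℝ} (hh : 0 ≤ h) :
    ∫ t, inner ℝ (∫ τ in (t - h)..t, V τ) (Φ t) =
      ∫ σ in (0 : ℝ)..h, ∫ t, inner ℝ (V (t - σ)) (Φ t) := by
  have hloc : ∀ a b, IntervalIntegrable V volume a b := fun a b =>
    ((hV.locallyIntegrable (by norm_num)).integrableOn_isCompact isCompact_uIcc).intervalIntegrable
  have hmeas : AEStronglyMeasurable (fun p : ℝ × ℝ => inner ℝ (V (p.1 - p.2)) (Φ p.1))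
      (volume.prod (volume.restrict (Ioc 0 h))) := by
    have h1 : AEStronglyMeasurable (fun p : ℝ × ℝ => V (p.1 - p.2))
        (volume.prod (volume.restrict (Ioc 0 h))) := by
      refine (hV.1.comp_quasiMeasurePreserving
        (quasiMeasurePreserving_sub_of_right_invariant volume volume)).mono_ac ?_
      exact Measure.AbsolutelyContinuous.rfl.prod Measure.absolutelyContinuous_restrict
    exact h1.inner hΦ.1.comp_fst
  have hint : Integrable (fun p : ℝ × ℝ => inner ℝ (V (p.1 - p.2)) (Φ p.1))
      (volume.prod (volume.restrict (Ioc 0 h))) := by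
    rw [integrable_prod_iff' hmeas]
    refine ⟨Eventually.of_forall fun σ =>
      integrable_inner_of_memLp (memLp_comp_sub_right hV σ) hΦ, ?_⟩
    refine Integrable.of_bound (C := (∫ t, ‖V t‖ ^ 2) + ∫ t, ‖Φ t‖ ^ 2)
      hmeas.norm.prod_swap.integral_prod_right' (Eventually.of_forall fun σ => ?_)
    rw [Real.norm_of_nonneg (integral_nonneg fun _ => norm_nonneg _)]
    exact integral_norm_inner_comp_sub_le hV hΦ σ
  rw [intervalIntegral.integral_of_le hh]
  rw [← integral_integral_swap (f := fun t σ => inner ℝ (V (t - σ)) (Φ t)) hint]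
  refine integral_congr_ae (Eventually.of_forall fun t => ?_)
  have h1 : ∫ τ in (t - h)..t, V τ = ∫ σ in (0 : ℝ)..h, V (t - σ) := by
    rw [intervalIntegral.integral_comp_sub_left, sub_zero]
  simp only
  rw [← intervalIntegral.integral_of_le hh, h1, real_inner_comm]
  have h2 : IntervalIntegrable (fun σ => V (t - σ)) volume 0 h := by
    have := (hloc (t - 0) (t - h)).comp_sub_left t
    simpa using this
  rw [← innerSL_apply_apply ℝ, ← ContinuousLinearMap.intervalIntegral_comp_comm _ h2]
  simp [real_inner_comm]

/-- Backward averages of a square integrable curve converge to the curve, weakly in `L²`. -/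
theorem tendsto_integral_inner_average {V Φ : ℝ → E} (hV : MemLp V 2 volume)
    (hΦ : MemLp Φ 2 volume) :
    Tendsto (fun h : ℝ => h⁻¹ * ∫ t, inner ℝ (∫ τ in (t - h)..t, V τ) (Φ t)) (𝓝[>] 0)
      (𝓝 (∫ t, inner ℝ (V t) (Φ t))) := by
  have hk := continuous_integral_inner_comp_sub hV hΦ
  have hd := (hk.integral_hasStrictDerivAt 0 0).hasDerivAt.tendsto_slope_zero_right
  simp only [sub_zero, zero_add, intervalIntegral.integral_same, smul_eq_mul] at hd
  refine hd.congr' ?_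
  filter_upwards [self_mem_nhdsWithin] with h hh
  rw [integral_inner_average hV hΦ (le_of_lt hh)]

/-- Backward averages of a continuous function converge. -/
theorem tendsto_inv_mul_integral {T : ℝ} {y : ℝ → ℝ} (hy : ContinuousOn y (Icc 0 T)) {s : ℝ}
    (hs0 : 0 < s) (hsT : s ≤ T) :
    Tendsto (fun h : ℝ => h⁻¹ * ∫ t in (s - h)..s, y t) (𝓝[>] 0) (𝓝 (y s)) := by
  have hT : 0 ≤ T := hs0.le.trans hsT
  set Y : ℝ → ℝ := IccExtend hT ((Icc 0 T).domRestrict y) with hY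
  have hYc : Continuous Y := (continuousOn_iff_continuous_domRestrict.1 hy).Icc_extend'
  have hYy : ∀ s ∈ Icc 0 T, Y s = y s := fun s hs => IccExtend_of_mem hT _ hs
  have hk : Continuous fun σ => Y (s - σ) := hYc.comp (continuous_const.sub continuous_id)
  have hd := (hk.integral_hasStrictDerivAt 0 0).hasDerivAt.tendsto_slope_zero_right
  simp only [sub_zero, zero_add, intervalIntegral.integral_same, smul_eq_mul] at hd
  rw [hYy s ⟨hs0.le, hsT⟩] at hd
  refine hd.congr' ?_
  filter_upwards [Ioo_mem_nhdsGT hs0] with h hh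
  rw [intervalIntegral.integral_comp_sub_left, sub_zero]
  congr 1
  refine intervalIntegral.integral_congr fun t ht => ?_
  rw [uIcc_of_le (by linarith [hh.1])] at ht
  exact hYy t ⟨by linarith [ht.1, hh.2], ht.2.trans hsT⟩

end Averages

section Quadratic

variable {α : Type*} {mα : MeasurableSpace α} {μ : Measure α}

theorem integral_mul_norm_le {G : α → ℝ} (hG : MemLp G 2 μ) (z : Lp ℝ 2 μ) :
    ∫ x, G x * ‖z x‖ ∂μ ≤ ‖hG.toLp G‖ * ‖z‖ := by
  have hz := (Lp.memLp z).norm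
  have h1 := real_inner_le_norm (hG.toLp G) (hz.toLp _)
  have h2 : ‖hz.toLp (fun x => ‖z x‖)‖ = ‖z‖ := by
    rw [Lp.norm_toLp, eLpNorm_norm, Lp.norm_def]
  rw [h2, L2.inner_def] at h1
  refine le_trans (le_of_eq ?_) h1
  refine integral_congr_ae ?_
  filter_upwards [hG.coeFn_toLp, hz.coeFn_toLp] with x hx1 hx2
  rw [hx1, hx2]
  simp [mul_comm]

theorem integral_norm_sq_eq (z : Lp ℝ 2 μ) : ∫ x, ‖z x‖ ^ 2 ∂μ = ‖z‖ ^ 2 := by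
  rw [← real_inner_self_eq_norm_sq, L2.inner_def]
  simp

variable [IsFiniteMeasure μ] {P : ℝ → ℝ} {C : ℝ}

theorem continuous_of_quadratic_lipschitz
    (hP : ∀ a c, |P a - P c| ≤ C * (1 + |a| + |c|) * |a - c|) : Continuous P := by
  refine continuous_iff_continuousAt.2 fun c => tendsto_iff_dist_tendsto_zero.2 ?_
  refine squeeze_zero (g := fun a => C * (1 + |a| + |c|) * |a - c|) (fun _ => dist_nonneg)
    (fun a => hP a c) ?_
  have : Continuous fun a => C * (1 + |a| + |c|) * |a - c| := by fun_prop
  simpa using this.tendsto c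

theorem integrable_comp_of_quadratic_lipschitz
    (hP : ∀ a c, |P a - P c| ≤ C * (1 + |a| + |c|) * |a - c|) (v : Lp ℝ 2 μ) :
    Integrable (fun x => P (v x)) μ := by
  have hv := Lp.memLp v
  have h1 : Integrable (fun x => |P 0| + C * (‖v x‖ + ‖v x‖ ^ 2)) μ :=
    (integrable_const _).add (((hv.integrable (by norm_num)).norm.add
      (hv.integrable_norm_pow (by norm_num))).const_mul _)
  refine h1.mono' ((continuous_of_quadratic_lipschitz hP).comp_aestronglyMeasurable hv.1)
    (Filter.Eventually.of_forall fun x => ?_)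
  have h2 := hP (v x) 0
  have h3 := abs_sub_abs_le_abs_sub (P (v x)) (P 0)
  simp only [abs_zero, add_zero, sub_zero] at h2
  rw [Real.norm_eq_abs, Real.norm_eq_abs]
  linarith

theorem memLp_one_add_norm (v : Lp ℝ 2 μ) : MemLp (fun x => 1 + 2 * ‖v x‖) 2 μ :=
  MemLp.add (f := fun _ => (1 : ℝ)) (g := fun x => 2 * ‖v x‖) (memLp_const 1)
    ((Lp.memLp v).norm.const_mul 2)

theorem integrable_comp_mul
    (hP : ∀ a c, |P a - P c| ≤ C * (1 + |a| + |c|) * |a - c|) {η : α → ℝ} {M : ℝ}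
    (hη : AEStronglyMeasurable η μ) (hM : ∀ x, |η x| ≤ M) (v : Lp ℝ 2 μ) :
    Integrable (fun x => P (v x) * η x) μ :=
  (integrable_comp_of_quadratic_lipschitz hP v).mul_bdd hη
    (Filter.Eventually.of_forall fun x => hM x)

theorem abs_integral_comp_mul_sub_le (hC : 0 ≤ C)
    (hP : ∀ a c, |P a - P c| ≤ C * (1 + |a| + |c|) * |a - c|) {η : α → ℝ} {M : ℝ}
    (hη : AEStronglyMeasurable η μ) (hM0 : 0 ≤ M) (hM : ∀ x, |η x| ≤ M) (v w : Lp ℝ 2 μ) :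
    |∫ x, P (w x) * η x ∂μ - ∫ x, P (v x) * η x ∂μ| ≤
      C * M * (‖(memLp_one_add_norm v).toLp _‖ * ‖w - v‖ + ‖w - v‖ ^ 2) := by
  have hz := Lp.memLp (w - v)
  have hG := memLp_one_add_norm v
  have hI1 : Integrable (fun x => (1 + 2 * ‖v x‖) * ‖(w - v) x‖) μ := hG.integrable_mul hz.norm
  have hI2 : Integrable (fun x => ‖(w - v) x‖ ^ 2) μ := hz.integrable_norm_pow (by norm_num)
  have hbound : ∀ᵐ x ∂μ, ‖P (w x) * η x - P (v x) * η x‖ ≤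
      C * M * ((1 + 2 * ‖v x‖) * ‖(w - v) x‖ + ‖(w - v) x‖ ^ 2) := by
    filter_upwards [Lp.coeFn_sub w v] with x hx
    rw [hx, Pi.sub_apply, ← sub_mul, norm_mul]
    simp only [Real.norm_eq_abs]
    have h1 := hP (w x) (v x)
    have h2 : |w x| ≤ |v x| + |w x - v x| := by
      have := abs_add_le (v x) (w x - v x)
      simpa using this
    calc |P (w x) - P (v x)| * |η x|
        ≤ (C * (1 + |w x| + |v x|) * |w x - v x|) * M :=
          mul_le_mul h1 (hM x) (abs_nonneg _) ((abs_nonneg _).trans h1)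
      _ ≤ (C * (1 + 2 * |v x| + |w x - v x|) * |w x - v x|) * M := by
          exact mul_le_mul_of_nonneg_right (mul_le_mul_of_nonneg_right
            (mul_le_mul_of_nonneg_left (by linarith) hC) (abs_nonneg _)) hM0
      _ = _ := by ring
  rw [← integral_sub (integrable_comp_mul hP hη hM w) (integrable_comp_mul hP hη hM v),
    ← Real.norm_eq_abs]
  refine (norm_integral_le_of_norm_le ((hI1.add hI2).const_mul _) hbound).trans ?_
  have e : ∫ x, C * M * ((1 + 2 * ‖v x‖) * ‖(w - v) x‖ + ‖(w - v) x‖ ^ 2) ∂μ =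
      C * M * ((∫ x, (1 + 2 * ‖v x‖) * ‖(w - v) x‖ ∂μ) + ∫ x, ‖(w - v) x‖ ^ 2 ∂μ) := by
    rw [integral_const_mul, integral_add hI1 hI2]
  refine e.le.trans ?_
  rw [integral_norm_sq_eq]
  gcongr
  exact integral_mul_norm_le hG (w - v)

/-- Nemytskii operators of quadratic growth are continuous from `L²` to `L¹`; here tested
against a bounded function. -/
theorem continuous_integral_comp_mul (hC : 0 ≤ C)
    (hP : ∀ a c, |P a - P c| ≤ C * (1 + |a| + |c|) * |a - c|) {η : α → ℝ} {M : ℝ}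
    (hη : AEStronglyMeasurable η μ) (hM0 : 0 ≤ M) (hM : ∀ x, |η x| ≤ M) :
    Continuous fun v : Lp ℝ 2 μ => ∫ x, P (v x) * η x ∂μ := by
  refine continuous_iff_continuousAt.2 fun v => tendsto_iff_dist_tendsto_zero.2 ?_
  set D := ‖(memLp_one_add_norm v).toLp _‖
  refine squeeze_zero (g := fun w => C * M * (D * ‖w - v‖ + ‖w - v‖ ^ 2))
    (fun _ => dist_nonneg) (fun w => abs_integral_comp_mul_sub_le hC hP hη hM0 hM v w) ?_
  have : Continuous fun w : Lp ℝ 2 μ => C * M * (D * ‖w - v‖ + ‖w - v‖ ^ 2) := by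
    fun_prop
  simpa using this.tendsto v

end Quadratic

theorem deriv_arsinh (s : ℝ) : deriv Real.arsinh s = (√(1 + s ^ 2))⁻¹ :=
  (Real.hasDerivAt_arsinh s).deriv

theorem contDiff_sublin : ContDiff ℝ ∞ sublin := by
  unfold sublin
  refine contDiff_id.mul ?_
  refine ContDiff.rpow_const_of_ne (by fun_prop) fun x => by positivity

theorem deriv_sublin (s : ℝ) :
    deriv sublin s = (1 + s ^ 2) ^ (-(1 / 4) : ℝ) * (1 - s ^ 2 / 2 / (1 + s ^ 2)) := by
  have h1 : 0 < 1 + s ^ 2 := by positivity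
  have h2 : HasDerivAt (fun s : ℝ => 1 + s ^ 2) (2 * s) s := by
    simpa using (hasDerivAt_pow 2 s).const_add 1
  have h3 := (hasDerivAt_id s).mul (h2.rpow_const (p := (-(1 / 4) : ℝ)) (Or.inl h1.ne'))
  have h4 : deriv sublin s = _ := h3.deriv
  rw [h4, Real.rpow_sub_one h1.ne']
  simp only [id]
  field_simp
  ring

theorem deriv_sublin_sq_le (s : ℝ) : deriv sublin s ^ 2 ≤ deriv Real.arsinh s := by
  have h1 : 0 < 1 + s ^ 2 := by positivity
  have h2 : s ^ 2 / 2 / (1 + s ^ 2) ≤ 1 := by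
    rw [div_le_one h1]; nlinarith
  have h3 : 0 ≤ s ^ 2 / 2 / (1 + s ^ 2) := by positivity
  have h4 : ((1 + s ^ 2) ^ (-(1 / 4) : ℝ)) ^ 2 = (√(1 + s ^ 2))⁻¹ := by
    rw [← Real.rpow_natCast, ← Real.rpow_mul h1.le, Real.sqrt_eq_rpow, ← Real.rpow_neg h1.le]
    norm_num
  rw [deriv_sublin, deriv_arsinh, mul_pow, h4]
  refine mul_le_of_le_one_right (by positivity) ?_
  exact pow_le_one₀ (by linarith) (by linarith)

theorem abs_deriv_arsinh_le (s : ℝ) : |deriv Real.arsinh s| ≤ ((1 : NNReal) : ℝ) := by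
  rw [deriv_arsinh, abs_of_nonneg (by positivity), NNReal.coe_one]
  refine inv_le_one_of_one_le₀ ?_
  rw [Real.one_le_sqrt]
  nlinarith

theorem abs_deriv_sublin_le (s : ℝ) : |deriv sublin s| ≤ ((1 : NNReal) : ℝ) := by
  rw [NNReal.coe_one, ← sq_le_one_iff_abs_le_one]
  have := abs_deriv_arsinh_le s
  rw [NNReal.coe_one] at this
  exact (deriv_sublin_sq_le s).trans ((le_abs_self _).trans this)

theorem sublin_zero : sublin 0 = 0 := by simp [sublin]

variable {N : ℕ} {Ω : Opens (Eucl N)}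

/-- The operator `w ↦ arsinh w` on `W₀^{1,2}(Ω)`. -/
structure IsArsinhComp (Φ : W012 Ω → W012 Ω) : Prop where
  continuous : Continuous Φ
  fn : ∀ w : W012 Ω, (Φ w).fn =ᵐ[volume.restrict (Ω : Set (Eucl N))] fun x => Real.arsinh (w.fn x)
  grad : ∀ w : W012 Ω, (Φ w).grad =ᵐ[volume.restrict (Ω : Set (Eucl N))]
    fun x => deriv Real.arsinh (w.fn x) • w.grad x

theorem exists_isArsinhComp (Ω : Opens (Eucl N)) : ∃ Φ : W012 Ω → W012 Ω, IsArsinhComp Φ := by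
  obtain ⟨Φ, h1, h2⟩ := exists_comp Ω Real.contDiff_arsinh Real.arsinh_zero abs_deriv_arsinh_le
  exact ⟨Φ, h1, fun w => (h2 w).1, fun w => (h2 w).2⟩

theorem IsArsinhComp.norm_grad_le {Φ : W012 Ω → W012 Ω} (hΦ : IsArsinhComp Φ) (w : W012 Ω) :
    ‖(Φ w).grad‖ ≤ ‖w.grad‖ := by
  refine Lp.norm_le_norm_of_ae_le ?_
  filter_upwards [hΦ.grad w] with x hx
  rw [hx, norm_smul]
  exact mul_le_of_le_one_left (norm_nonneg _) (by simpa using abs_deriv_arsinh_le (w.fn x))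

/-- The dissipation controls a power, of exponent less than one, of the energy. -/
theorem IsArsinhComp.exists_dissipation {Φ : W012 Ω → W012 Ω} (hΦ : IsArsinhComp Φ)
    {b : ℝ → ℝ} {e₀ δ : ℝ} (hb : IsSlowRate b e₀) (hδ : 0 < δ) (hδe : 4 * δ ≤ e₀)
    {S : NNReal} (hS : ∀ w : W012 Ω, eLpNorm w.fn (ENNReal.ofReal (2 + 4 * δ))
      (volume.restrict (Ω : Set (Eucl N))) ≤ S * ‖w.grad‖ₑ) :
    ∃ c, 0 < c ∧ ∀ w : W012 Ω,
      c * (∫ x in (Ω : Set (Eucl N)), rateEnergy b (w.fn x)) ^ (2 / (2 + 4 * δ)) ≤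
        inner ℝ w.grad (Φ w).grad := by
  obtain ⟨Γ, -, hΓ⟩ := exists_comp Ω contDiff_sublin sublin_zero abs_deriv_sublin_le
  obtain ⟨C, hC, hF⟩ := hb.exists_rateEnergy_le hδ hδe
  set r : ℝ := 2 + 4 * δ with hr
  have hr0 : 0 < r := by positivity
  refine ⟨(C ^ (2 / r) * (S + 1) ^ 2)⁻¹, by positivity, fun w => ?_⟩
  have h1 : ‖(Γ w).grad‖ ^ 2 ≤ inner ℝ w.grad (Φ w).grad := by
    rw [← real_inner_self_eq_norm_sq, L2.inner_def, L2.inner_def]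
    refine integral_mono_ae (L2.integrable_inner _ _) (L2.integrable_inner _ _) ?_
    filter_upwards [(hΓ w).2, hΦ.grad w] with x hx1 hx2
    rw [hx1, hx2, real_inner_smul_left, real_inner_smul_right, real_inner_smul_right,
      ← mul_assoc, ← pow_two]
    exact mul_le_mul_of_nonneg_right (deriv_sublin_sq_le _) real_inner_self_nonneg
  have hΓr : MemLp (Γ w).fn (ENNReal.ofReal r) (volume.restrict (Ω : Set (Eucl N))) :=
    ⟨Lp.aestronglyMeasurable _, (hS (Γ w)).trans_lt (by finiteness)⟩
  have hrr : (ENNReal.ofReal r).toReal = r := ENNReal.toReal_ofReal hr0.le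
  have hne0 : ENNReal.ofReal r ≠ 0 := by simpa using hr0
  have h2 : (∫ x in (Ω : Set (Eucl N)), ‖(Γ w).fn x‖ ^ r) ^ r⁻¹ ≤ (S + 1) * ‖(Γ w).grad‖ := by
    have h := hS (Γ w)
    rw [hΓr.eLpNorm_eq_integral_rpow_norm hne0 ENNReal.ofReal_ne_top, hrr] at h
    have h' := (ENNReal.ofReal_le_iff_le_toReal (by finiteness)).1 h
    rw [ENNReal.toReal_mul, toReal_enorm, ENNReal.coe_toReal] at h'
    refine h'.trans ?_
    gcongr
    linarith
  have h3 : ∫ x in (Ω : Set (Eucl N)), rateEnergy b (w.fn x) ≤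
      C * ∫ x in (Ω : Set (Eucl N)), ‖(Γ w).fn x‖ ^ r := by
    rw [← integral_const_mul]
    have hi := hΓr.integrable_norm_rpow hne0 ENNReal.ofReal_ne_top
    rw [hrr] at hi
    refine integral_mono_of_nonneg (Filter.Eventually.of_forall fun x => hb.rateEnergy_nonneg _)
      (hi.const_mul C) ?_
    filter_upwards [(hΓ w).1] with x hx
    rw [hx]
    exact hF _
  have hI0 : 0 ≤ ∫ x in (Ω : Set (Eucl N)), ‖(Γ w).fn x‖ ^ r :=
    integral_nonneg fun x => by positivity
  have hE0 : 0 ≤ ∫ x in (Ω : Set (Eucl N)), rateEnergy b (w.fn x) :=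
    integral_nonneg fun x => hb.rateEnergy_nonneg _
  rw [inv_mul_le_iff₀ (by positivity)]
  calc (∫ x in (Ω : Set (Eucl N)), rateEnergy b (w.fn x)) ^ (2 / r)
      ≤ (C * ∫ x in (Ω : Set (Eucl N)), ‖(Γ w).fn x‖ ^ r) ^ (2 / r) :=
        Real.rpow_le_rpow hE0 h3 (by positivity)
    _ = C ^ (2 / r) * ((∫ x in (Ω : Set (Eucl N)), ‖(Γ w).fn x‖ ^ r) ^ r⁻¹) ^ 2 := by
        rw [Real.mul_rpow hC.le hI0, ← Real.rpow_natCast (_ ^ r⁻¹), ← Real.rpow_mul hI0]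
        congr 2
        push_cast
        ring
    _ ≤ C ^ (2 / r) * ((S + 1) * ‖(Γ w).grad‖) ^ 2 := by gcongr
    _ = C ^ (2 / r) * (S + 1) ^ 2 * ‖(Γ w).grad‖ ^ 2 := by ring
    _ ≤ _ := by gcongr

/-- Pairing with a function in the dual Lebesgue space is continuous on `W₀^{1,2}(Ω)`. -/
theorem integrable_and_continuous_pairing {p q : ℝ≥0∞} [ENNReal.HolderConjugate p q] {S : NNReal}
    (hS : ∀ w : W012 Ω, eLpNorm w.fn q (volume.restrict (Ω : Set (Eucl N))) ≤ S * ‖w.grad‖ₑ)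
    {β : Eucl N → ℝ} (hβ : MemLp β p (volume.restrict (Ω : Set (Eucl N)))) :
    (∀ w : W012 Ω, IntegrableOn (fun x => β x * w.fn x) (Ω : Set (Eucl N))) ∧
      Continuous fun w : W012 Ω => ∫ x in (Ω : Set (Eucl N)), β x * w.fn x := by
  have hq : ∀ w : W012 Ω, MemLp w.fn q (volume.restrict (Ω : Set (Eucl N))) := fun w =>
    ⟨Lp.aestronglyMeasurable _, (hS w).trans_lt (by finiteness)⟩
  have hint : ∀ w : W012 Ω, IntegrableOn (fun x => β x * w.fn x) (Ω : Set (Eucl N)) :=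
    fun w => hβ.integrable_mul (hq w)
  refine ⟨hint, ?_⟩
  let ℓ : W012 Ω →ₗ[ℝ] ℝ :=
    { toFun := fun w => ∫ x in (Ω : Set (Eucl N)), β x * w.fn x
      map_add' := fun w z => by
        rw [← integral_add (hint w) (hint z)]
        refine integral_congr_ae ?_
        filter_upwards [Lp.coeFn_add w.fn z.fn] with x hx
        have : (w + z).fn = w.fn + z.fn := map_add W012.fnL w z
        rw [this, hx, Pi.add_apply, mul_add]
      map_smul' := fun c w => by
        rw [RingHom.id_apply, smul_eq_mul, ← integral_const_mul]
        refine integral_congr_ae ?_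
        filter_upwards [Lp.coeFn_smul c w.fn] with x hx
        have : (c • w).fn = c • w.fn := map_smul W012.fnL c w
        rw [this, hx, Pi.smul_apply, smul_eq_mul]
        ring }
  refine (ℓ.mkContinuous ((eLpNorm β p (volume.restrict (Ω : Set (Eucl N)))).toReal * S *
    ‖W012.gradL (Ω := Ω)‖) fun w => ?_).continuous
  have h1 : ‖∫ x in (Ω : Set (Eucl N)), β x * w.fn x‖ₑ ≤
      eLpNorm β p (volume.restrict (Ω : Set (Eucl N))) * (S * ‖w.grad‖ₑ) := by
    refine (enorm_integral_le_lintegral_enorm _).trans ?_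
    rw [← eLpNorm_one_eq_lintegral_enorm]
    refine (eLpNorm_smul_le_mul_eLpNorm (p := p) (q := q) (r := 1) (hq w).1 hβ.1).trans ?_
    gcongr
    exact hS w
  have h2 := ENNReal.toReal_mono (by have := hβ.2.ne; finiteness) h1
  rw [ENNReal.toReal_mul, ENNReal.toReal_mul, toReal_enorm, toReal_enorm,
    ENNReal.coe_toReal] at h2
  refine h2.trans ?_
  rw [mul_assoc, mul_assoc]
  gcongr
  exact W012.gradL.le_opNorm w

theorem memLp_ratePrim {α : Type*} {mα : MeasurableSpace α} {μ : Measure α} [IsFiniteMeasure μ]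
    {b : ℝ → ℝ} {e₀ δ : ℝ} (hb : IsSlowRate b e₀) (hδ : 0 < δ) (hδe : 4 * δ ≤ e₀)
    (hδ1 : 2 * δ ≤ 1) (v : Lp ℝ 2 μ) :
    MemLp (fun x => ratePrim b (v x)) (ENNReal.ofReal ((2 + 4 * δ) / (1 + 4 * δ))) μ := by
  obtain ⟨C, hC, h⟩ := hb.exists_ratePrim_le hδ (by linarith)
  obtain ⟨K, hK, hlip⟩ := hb.exists_ratePrim_lipschitz (by linarith)
  have h1 : MemLp (fun x => ‖v x‖ ^ (1 + δ)) (2 / ENNReal.ofReal (1 + δ)) μ := by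
    have := (Lp.memLp v).norm_rpow_div (ENNReal.ofReal (1 + δ))
    rwa [ENNReal.toReal_ofReal (by linarith)] at this
  have h2 : ENNReal.ofReal ((2 + 4 * δ) / (1 + 4 * δ)) ≤ 2 / ENNReal.ofReal (1 + δ) := by
    rw [← ENNReal.ofReal_ofNat, ← ENNReal.ofReal_div_of_pos (by linarith)]
    refine ENNReal.ofReal_le_ofReal ?_
    rw [div_le_div_iff₀ (by linarith) (by linarith)]
    nlinarith
  refine (h1.mono_exponent h2).of_le_mul (c := C)
    ((continuous_of_quadratic_lipschitz hlip).comp_aestronglyMeasurable (Lp.aestronglyMeasurable _))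
    (Filter.Eventually.of_forall fun x => ?_)
  rw [Real.norm_of_nonneg (hb.ratePrim_nonneg _), Real.norm_of_nonneg (by positivity)]
  exact h _

theorem holderConjugate_ofReal {δ : ℝ} (hδ : 0 < δ) :
    ENNReal.HolderConjugate (ENNReal.ofReal ((2 + 4 * δ) / (1 + 4 * δ)))
      (ENNReal.ofReal (2 + 4 * δ)) := by
  refine Real.HolderConjugate.ennrealOfReal ?_
  rw [Real.holderConjugate_iff]
  refine ⟨by rw [lt_div_iff₀ (by linarith)]; linarith, ?_⟩
  field_simp
  ring

/-- `v` is a weak solution of `(B v)_t = Δ v` on `(0,T)`, with `B' = b` and zero lateral boundary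
values: `v` is continuous with values in `L²(Ω)`, and `V` is the same curve in `W₀^{1,2}(Ω)`. -/
structure IsWeakSolution (b : ℝ → ℝ) (T : ℝ) (v : ℝ → L2 Ω) (V : ℝ → W012 Ω) : Prop where
  continuousOn : ContinuousOn v (Icc 0 T)
  ae_eq : ∀ᵐ t ∂(volume.restrict (Ioo 0 T)), (V t).fn = v t
  memLp : MemLp V 2 (volume.restrict (Ioo 0 T))
  weak : ∀ (ψ : 𝓓((⟨Ioo 0 T, isOpen_Ioo⟩ : Opens ℝ), ℝ)) (η : 𝓓(Ω, ℝ)),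
    ∫ t in Ioo 0 T, deriv (fun s => ψ s) t *
        ∫ x in (Ω : Set (Eucl N)), ratePrim b (v t x) * η x =
      ∫ t in Ioo 0 T, ψ t * inner ℝ (V t).grad (W012.ofTest η).grad

theorem IsRegularSolution.exists_isWeakSolution {m : ℝ} (hm0 : 0 < m) (hm1 : m < 1)
    {u₀ : Eucl N → ℝ} {T : ℝ} {u : ℝ → Eucl N → ℝ} (hu : IsRegularSolution m Ω u₀ T u) :
    ∃ (v : ℝ → L2 Ω) (V : ℝ → W012 Ω), IsWeakSolution (betaDeriv m) T v V ∧
      ∀ t ∈ Icc 0 T, ∀ᵐ x ∂(volume.restrict (Ω : Set (Eucl N))), v t x = H m (u t x ^ m) := by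
  obtain ⟨v, V, G, hv, hvc, hVv, hV, hG, hder, heq⟩ := hu.regular
  refine ⟨v, V, ⟨hvc, hVv, hV, fun ψ η => ?_⟩, hv⟩
  have hψc : Continuous fun t => ψ t • W012.ofTest η := ψ.continuous.smul continuous_const
  have hψ : MemLp (fun t => ψ t • W012.ofTest η) 2 (volume.restrict (Ioo 0 T)) :=
    hψc.memLp_of_hasCompactSupport (ψ.hasCompactSupport.smul_right)
  have h1 := heq _ hψ
  have h2 := hder ψ η
  have e1 : ∀ t, ∫ x in (Ω : Set (Eucl N)),
      inner ℝ ((V t).grad x) ((ψ t • W012.ofTest η).grad x) =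
        ψ t * inner ℝ (V t).grad (W012.ofTest η).grad := fun t => by
    rw [← L2.inner_def]
    have : (ψ t • W012.ofTest η).grad = ψ t • (W012.ofTest η).grad :=
      map_smul W012.gradL (ψ t) (W012.ofTest η)
    rw [this, real_inner_smul_right]
  simp only [e1, map_smul, smul_eq_mul] at h1
  have e2 : ∫ t in Ioo 0 T, deriv (fun s => ψ s) t *
        ∫ x in (Ω : Set (Eucl N)), ratePrim (betaDeriv m) (v t x) * η x =
      ∫ t in Ioo 0 T, deriv (fun s => ψ s) t *
        ∫ x in (Ω : Set (Eucl N)), beta m (H m (u t x ^ m)) * η x := by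
    refine setIntegral_congr_fun measurableSet_Ioo fun t ht => ?_
    have ht' : t ∈ Icc 0 T := Ioo_subset_Icc_self ht
    congr 1
    refine integral_congr_ae ?_
    filter_upwards [hv t ht', hu.nonneg t ht'] with x hx1 hx2
    have h0 : 0 ≤ H m (u t x ^ m) := by
      have := Real.rpow_nonneg hx2 m
      exact this.trans (le_H hm0 hm1 this)
    rw [hx1, beta_eq_integral_betaDeriv m h0, ratePrim]
  rw [e2]
  linarith

namespace IsWeakSolution

variable {b : ℝ → ℝ} {T : ℝ} {v : ℝ → L2 Ω} {V : ℝ → W012 Ω}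

theorem memLp_grad (h : IsWeakSolution b T v V) :
    MemLp (fun t => (V t).grad) 2 (volume.restrict (Ioo 0 T)) :=
  (W012.gradL (Ω := Ω)).comp_memLp' h.memLp

theorem intervalIntegrable_grad (h : IsWeakSolution b T v V) {s t : ℝ} (hs : 0 ≤ s)
    (hst : s ≤ t) (ht : t ≤ T) : IntervalIntegrable (fun t => (V t).grad) volume s t := by
  rw [intervalIntegrable_iff_integrableOn_Ioo_of_le hst]
  exact IntegrableOn.mono_set (h.memLp_grad.integrable (by norm_num)) (Ioo_subset_Ioo hs ht)

/-- The equation, integrated in time and tested against an arbitrary element of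
`W₀^{1,2}(Ω)`. -/
theorem integral_sub_mul_eq (h : IsWeakSolution b T v V) (hT : 0 < T)
    (hΩ : Bornology.IsBounded (Ω : Set (Eucl N)))
    {e₀ δ : ℝ} (hb : IsSlowRate b e₀) (hδ : 0 < δ) (hδe : 4 * δ ≤ e₀) (hδ1 : 2 * δ ≤ 1)
    {S : NNReal} (hS : ∀ w : W012 Ω, eLpNorm w.fn (ENNReal.ofReal (2 + 4 * δ))
      (volume.restrict (Ω : Set (Eucl N))) ≤ S * ‖w.grad‖ₑ)
    {s t : ℝ} (hs : 0 ≤ s) (hst : s ≤ t) (ht : t ≤ T) (w : W012 Ω) :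
    ∫ x in (Ω : Set (Eucl N)), (ratePrim b (v t x) - ratePrim b (v s x)) * w.fn x =
      -inner ℝ (∫ τ in s..t, (V τ).grad) w.grad := by
  have := isFiniteMeasure_restrict_of_isBounded hΩ
  have := holderConjugate_ofReal hδ
  obtain ⟨C, hC, hlip⟩ := hb.exists_ratePrim_lipschitz (by linarith)
  have hpair := (integrable_and_continuous_pairing hS
    ((memLp_ratePrim hb hδ hδe hδ1 (v t)).sub (memLp_ratePrim hb hδ hδe hδ1 (v s)))).2
  have hrhs : Continuous fun w : W012 Ω => -inner ℝ (∫ τ in s..t, (V τ).grad) w.grad :=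
    (continuous_const.inner W012.gradL.continuous).neg
  refine congrFun (W012.denseRange_ofTest.equalizer hpair hrhs (funext fun η => ?_)) w
  obtain ⟨M, hM⟩ := η.continuous.bounded_above_of_compact_support η.hasCompactSupport
  have hM0 : 0 ≤ M := (norm_nonneg _).trans (hM 0)
  have hη : AEStronglyMeasurable (fun x => η x) (volume.restrict (Ω : Set (Eucl N))) :=
    η.continuous.aestronglyMeasurable
  have hgi : ∀ {s t : ℝ}, 0 ≤ s → s ≤ t → t ≤ T → ∫ τ in s..t,
      inner ℝ (V τ).grad (W012.ofTest η).grad =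
        inner ℝ (∫ τ in s..t, (V τ).grad) (W012.ofTest η).grad := fun hs hst ht => by
    simp_rw [real_inner_comm (W012.ofTest η).grad]
    have := ((innerSL ℝ) (W012.ofTest η).grad).intervalIntegral_comp_comm
      (h.intervalIntegrable_grad hs hst ht)
    simpa only [innerSL_apply_apply] using this
  have key := sub_eq_neg_integral_of_weakDeriv hT
    (B := fun t => ∫ x in (Ω : Set (Eucl N)), ratePrim b (v t x) * η x)
    (a := fun t => inner ℝ (V t).grad (W012.ofTest η).grad)
    ((continuous_integral_comp_mul hC hlip hη hM0 hM).comp_continuousOn h.continuousOn)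
    ((h.memLp_grad.integrable (by norm_num)).inner_const _) (fun ψ => h.weak ψ η) hs hst ht
  rw [hgi hs hst ht] at key
  simp only [Function.comp]
  rw [← key, ← integral_sub (integrable_comp_mul hlip hη hM _)
    (integrable_comp_mul hlip hη hM _)]
  refine integral_congr_ae ?_
  filter_upwards [W012.fn_ofTest η] with x hx
  simp only [Pi.sub_apply]
  rw [hx, sub_mul]

/-- The energy inequality between two times, the later one being generic. -/
theorem energy_sub_le (h : IsWeakSolution b T v V) (hT : 0 < T)
    (hΩ : Bornology.IsBounded (Ω : Set (Eucl N)))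
    {e₀ δ : ℝ} (hb : IsSlowRate b e₀) (hδ : 0 < δ) (hδe : 4 * δ ≤ e₀) (hδ1 : 2 * δ ≤ 1)
    {S : NNReal} (hS : ∀ w : W012 Ω, eLpNorm w.fn (ENNReal.ofReal (2 + 4 * δ))
      (volume.restrict (Ω : Set (Eucl N))) ≤ S * ‖w.grad‖ₑ)
    {Φ : W012 Ω → W012 Ω} (hΦ : IsArsinhComp Φ)
    {s t : ℝ} (hs : 0 ≤ s) (hst : s ≤ t) (ht : t ≤ T) (hVt : (V t).fn = v t) :
    (∫ x in (Ω : Set (Eucl N)), rateEnergy b (v t x)) -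
        ∫ x in (Ω : Set (Eucl N)), rateEnergy b (v s x) ≤
      -inner ℝ (∫ τ in s..t, (V τ).grad) (Φ (V t)).grad := by
  have := isFiniteMeasure_restrict_of_isBounded hΩ
  have := holderConjugate_ofReal hδ
  obtain ⟨C, hC, hlip⟩ := hb.exists_rateEnergy_lipschitz (by linarith)
  have hpair := (integrable_and_continuous_pairing hS
    ((memLp_ratePrim hb hδ hδe hδ1 (v t)).sub (memLp_ratePrim hb hδ hδe hδ1 (v s)))).1 (Φ (V t))
  rw [← h.integral_sub_mul_eq hT hΩ hb hδ hδe hδ1 hS hs hst ht,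
    ← integral_sub (integrable_comp_of_quadratic_lipschitz hlip _)
      (integrable_comp_of_quadratic_lipschitz hlip _)]
  refine integral_mono_ae ((integrable_comp_of_quadratic_lipschitz hlip _).sub
    (integrable_comp_of_quadratic_lipschitz hlip _)) hpair ?_
  filter_upwards [hΦ.fn (V t)] with x hx
  rw [hx, hVt, mul_comm]
  exact hb.rateEnergy_sub_le _ _

theorem continuousOn_energy (h : IsWeakSolution b T v V)
    (hΩ : Bornology.IsBounded (Ω : Set (Eucl N))) {e₀ : ℝ} (hb : IsSlowRate b e₀)
    (he₀ : 0 < e₀) :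
    ContinuousOn (fun t => ∫ x in (Ω : Set (Eucl N)), rateEnergy b (v t x)) (Icc 0 T) := by
  have := isFiniteMeasure_restrict_of_isBounded hΩ
  obtain ⟨C, hC, hlip⟩ := hb.exists_rateEnergy_lipschitz he₀
  have := (continuous_integral_comp_mul (μ := volume.restrict (Ω : Set (Eucl N)))
    (η := fun _ => (1 : ℝ)) (M := 1) hC hlip aestronglyMeasurable_const zero_le_one
    (by simp)).comp_continuousOn h.continuousOn
  simpa [Function.comp_def] using this

theorem memLp_grad_comp (h : IsWeakSolution b T v V) {Φ : W012 Ω → W012 Ω}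
    (hΦ : IsArsinhComp Φ) :
    MemLp (fun t => (Φ (V t)).grad) 2 (volume.restrict (Ioo 0 T)) :=
  h.memLp_grad.of_le
    ((W012.gradL.continuous.comp hΦ.continuous).comp_aestronglyMeasurable h.memLp.1)
    (Filter.Eventually.of_forall fun t => hΦ.norm_grad_le (V t))

open Filter Topology in
/-- The energy inequality. -/
theorem energy_le (h : IsWeakSolution b T v V) (hT : 0 < T)
    (hΩ : Bornology.IsBounded (Ω : Set (Eucl N)))
    {e₀ δ : ℝ} (hb : IsSlowRate b e₀) (hδ : 0 < δ) (hδe : 4 * δ ≤ e₀) (hδ1 : 2 * δ ≤ 1)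
    {S : NNReal} (hS : ∀ w : W012 Ω, eLpNorm w.fn (ENNReal.ofReal (2 + 4 * δ))
      (volume.restrict (Ω : Set (Eucl N))) ≤ S * ‖w.grad‖ₑ)
    {Φ : W012 Ω → W012 Ω} (hΦ : IsArsinhComp Φ)
    {s t : ℝ} (hs : 0 < s) (hst : s ≤ t) (ht : t ≤ T) :
    (∫ x in (Ω : Set (Eucl N)), rateEnergy b (v t x)) -
        ∫ x in (Ω : Set (Eucl N)), rateEnergy b (v s x) ≤
      -∫ τ in s..t, inner ℝ (V τ).grad (Φ (V τ)).grad := by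
  set y : ℝ → ℝ := fun t => ∫ x in (Ω : Set (Eucl N)), rateEnergy b (v t x) with hy
  have hyc : ContinuousOn y (Icc 0 T) := h.continuousOn_energy hΩ hb (by linarith)
  set A : ℝ → L2Vec Ω := (Ioc 0 T).indicator fun t => (V t).grad with hA
  set D : ℝ → L2Vec Ω := (Ioc s t).indicator fun t => (Φ (V t)).grad with hD
  have hsub : Ioc s t ⊆ Ioc 0 T := Ioc_subset_Ioc hs.le ht
  have hAL : MemLp A 2 volume := by
    rw [hA, memLp_indicator_iff_restrict measurableSet_Ioc, ← restrict_Ioo_eq_restrict_Ioc]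
    exact h.memLp_grad
  have hDL : MemLp D 2 volume := by
    rw [hD, memLp_indicator_iff_restrict measurableSet_Ioc]
    have := h.memLp_grad_comp hΦ
    rw [restrict_Ioo_eq_restrict_Ioc] at this
    exact this.mono_measure (Measure.restrict_mono hsub le_rfl)
  have hDset : ∀ F : ℝ → L2Vec Ω, ∫ τ, inner ℝ (F τ) (D τ) =
      ∫ τ in s..t, inner ℝ (F τ) (Φ (V τ)).grad := fun F => by
    rw [intervalIntegral.integral_of_le hst, ← integral_indicator measurableSet_Ioc]
    congr 1
    funext τ
    by_cases hτ : τ ∈ Ioc s t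
    · simp [hD, hτ]
    · simp [hD, hτ]
  have hlim1 : Tendsto (fun r : ℝ => r⁻¹ * (∫ τ in (t - r)..t, y τ) -
      r⁻¹ * ∫ τ in (s - r)..s, y τ) (𝓝[>] 0) (𝓝 (y t - y s)) :=
    (tendsto_inv_mul_integral hyc (hs.trans_le hst) ht).sub
      (tendsto_inv_mul_integral hyc hs (hst.trans ht))
  have hlim2 := (tendsto_integral_inner_average hAL hDL).neg
  rw [hDset A] at hlim2
  have hAV : ∫ τ in s..t, inner ℝ (A τ) (Φ (V τ)).grad =
      ∫ τ in s..t, inner ℝ (V τ).grad (Φ (V τ)).grad := by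
    rw [intervalIntegral.integral_of_le hst, intervalIntegral.integral_of_le hst]
    refine setIntegral_congr_fun measurableSet_Ioc fun τ hτ => ?_
    simp only [hA, indicator_of_mem (hsub hτ)]
  rw [hAV] at hlim2
  refine le_of_tendsto_of_tendsto hlim1 hlim2 ?_
  filter_upwards [Ioo_mem_nhdsGT hs] with r hr
  have hyi : ∀ {p q : ℝ}, p ∈ Icc 0 T → q ∈ Icc 0 T → IntervalIntegrable y volume p q :=
    fun hp hq => (hyc.mono (uIcc_subset_Icc hp hq)).intervalIntegrable
  have hm1 : s - r ∈ Icc 0 T := ⟨by linarith [hr.2], by linarith [hr.1]⟩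
  have hm2 : s ∈ Icc 0 T := ⟨hs.le, hst.trans ht⟩
  have hm3 : t - r ∈ Icc 0 T := ⟨by linarith [hr.2], by linarith [hr.1]⟩
  have hm4 : t ∈ Icc 0 T := ⟨hs.le.trans hst, ht⟩
  have hysh : IntervalIntegrable (fun τ => y (τ - r)) volume s t := by
    have := (hyi hm1 hm3).comp_sub_right r
    simpa using this
  have hleft : (∫ τ in (t - r)..t, y τ) - ∫ τ in (s - r)..s, y τ =
      ∫ τ in s..t, (y τ - y (τ - r)) := by
    rw [intervalIntegral.integral_sub (hyi hm2 hm4) hysh, intervalIntegral.integral_comp_sub_right]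
    have e1 := intervalIntegral.integral_add_adjacent_intervals (hyi hm1 hm2) (hyi hm2 hm4)
    have e2 := intervalIntegral.integral_add_adjacent_intervals (hyi hm1 hm3) (hyi hm3 hm4)
    linarith
  have hAloc : ∀ p q, IntervalIntegrable A volume p q := fun p q =>
    ((hAL.locallyIntegrable (by norm_num)).integrableOn_isCompact
      isCompact_uIcc).intervalIntegrable
  have hAc : Continuous fun τ => ∫ σ in (τ - r)..τ, A σ := by
    have hp := intervalIntegral.continuous_primitive hAloc 0
    have : (fun τ => ∫ σ in (τ - r)..τ, A σ) =
        fun τ => (∫ σ in (0 : ℝ)..τ, A σ) - ∫ σ in (0 : ℝ)..(τ - r), A σ := funext fun τ =>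
      (intervalIntegral.integral_interval_sub_left (hAloc _ _) (hAloc _ _)).symm
    rw [this]
    exact hp.sub (hp.comp (continuous_id.sub continuous_const))
  have hright : IntervalIntegrable
      (fun τ => inner ℝ (∫ σ in (τ - r)..τ, A σ) (Φ (V τ)).grad) volume s t := by
    rw [intervalIntegrable_iff_integrableOn_Ioc_of_le hst]
    refine integrable_inner_of_memLp ?_ ?_
    · obtain ⟨K, hK⟩ := isCompact_Icc.exists_bound_of_continuousOn (hAc.continuousOn (s := Icc s t))
      refine MemLp.of_bound hAc.aestronglyMeasurable K ?_
      filter_upwards [ae_restrict_mem measurableSet_Ioc] with τ hτ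
      exact hK τ (Ioc_subset_Icc_self hτ)
    · exact (memLp_indicator_iff_restrict measurableSet_Ioc).1 hDL
  rw [← mul_sub, hleft, hDset, ← mul_neg, ← intervalIntegral.integral_neg]
  refine mul_le_mul_of_nonneg_left ?_ (inv_nonneg.2 hr.1.le)
  refine intervalIntegral.integral_mono_ae_restrict hst ((hyi hm2 hm4).sub hysh) hright.neg ?_
  have hae : ∀ᵐ τ ∂(volume.restrict (Icc s t)), (V τ).fn = v τ := by
    have h1 := h.ae_eq
    rw [restrict_Ioo_eq_restrict_Icc] at h1
    exact ae_restrict_of_ae_restrict_of_subset (Icc_subset_Icc hs.le ht) h1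
  filter_upwards [hae, ae_restrict_mem measurableSet_Icc] with τ hτ hτm
  have hτT : τ ≤ T := hτm.2.trans ht
  have e := h.energy_sub_le hT hΩ hb hδ hδe hδ1 hS hΦ (s := τ - r) (t := τ)
    (by linarith [hr.2, hτm.1]) (by linarith [hr.1]) hτT hτ
  refine e.trans (le_of_eq ?_)
  have : ∫ σ in (τ - r)..τ, (V σ).grad = ∫ σ in (τ - r)..τ, A σ := by
    rw [intervalIntegral.integral_of_le (by linarith [hr.1]),
      intervalIntegral.integral_of_le (by linarith [hr.1])]
    refine setIntegral_congr_fun measurableSet_Ioc fun σ hσ => ?_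
    have : σ ∈ Ioc 0 T := ⟨by linarith [hσ.1, hr.2, hτm.1], hσ.2.trans hτT⟩
    simp only [hA, indicator_of_mem this]
  rw [this]

/-- The energy satisfies a differential inequality of extinction type. -/
theorem energy_sub_le_neg_integral_rpow (h : IsWeakSolution b T v V) (hT : 0 < T)
    (hΩ : Bornology.IsBounded (Ω : Set (Eucl N)))
    {e₀ δ : ℝ} (hb : IsSlowRate b e₀) (hδ : 0 < δ) (hδe : 4 * δ ≤ e₀) (hδ1 : 2 * δ ≤ 1)
    {S : NNReal} (hS : ∀ w : W012 Ω, eLpNorm w.fn (ENNReal.ofReal (2 + 4 * δ))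
      (volume.restrict (Ω : Set (Eucl N))) ≤ S * ‖w.grad‖ₑ)
    {Φ : W012 Ω → W012 Ω} (hΦ : IsArsinhComp Φ) {c : ℝ}
    (hc : ∀ w : W012 Ω,
      c * (∫ x in (Ω : Set (Eucl N)), rateEnergy b (w.fn x)) ^ (2 / (2 + 4 * δ)) ≤
        inner ℝ w.grad (Φ w).grad)
    {s t : ℝ} (hs : 0 ≤ s) (hst : s ≤ t) (ht : t ≤ T) :
    (∫ x in (Ω : Set (Eucl N)), rateEnergy b (v t x)) -
        ∫ x in (Ω : Set (Eucl N)), rateEnergy b (v s x) ≤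
      -(c * ∫ τ in s..t,
        (∫ x in (Ω : Set (Eucl N)), rateEnergy b (v τ x)) ^ (2 / (2 + 4 * δ))) := by
  set a := 2 / (2 + 4 * δ) with ha
  have ha0 : 0 ≤ a := by positivity
  set y : ℝ → ℝ := fun t => ∫ x in (Ω : Set (Eucl N)), rateEnergy b (v t x) with hy
  have hyc : ContinuousOn y (Icc 0 T) := h.continuousOn_energy hΩ hb (by linarith)
  have hyac : ContinuousOn (fun t => y t ^ a) (Icc 0 T) := hyc.rpow_const fun _ _ => Or.inr ha0
  have hyi : ∀ {p q : ℝ}, p ∈ Icc 0 T → q ∈ Icc 0 T →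
      IntervalIntegrable (fun t => y t ^ a) volume p q :=
    fun hp hq => (hyac.mono (uIcc_subset_Icc hp hq)).intervalIntegrable
  have hpos : ∀ p, 0 < p → p ≤ t → y t - y p + c * ∫ τ in p..t, y τ ^ a ≤ 0 := by
    intro p hp hpt
    have h1 := h.energy_le hT hΩ hb hδ hδe hδ1 hS hΦ hp hpt ht
    have h2 : ∫ τ in p..t, c * y τ ^ a ≤ ∫ τ in p..t, inner ℝ (V τ).grad (Φ (V τ)).grad := by
      refine intervalIntegral.integral_mono_ae_restrict hpt
        ((hyi ⟨hp.le, hpt.trans ht⟩ ⟨hs.trans hst, ht⟩).const_mul c) ?_ ?_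
      · rw [intervalIntegrable_iff_integrableOn_Ioo_of_le hpt]
        exact IntegrableOn.mono_set (integrable_inner_of_memLp h.memLp_grad
          (h.memLp_grad_comp hΦ)) (Ioo_subset_Ioo hp.le ht)
      · have h3 := h.ae_eq
        rw [restrict_Ioo_eq_restrict_Icc] at h3
        filter_upwards [ae_restrict_of_ae_restrict_of_subset (Icc_subset_Icc hp.le ht) h3] with τ hτ
        have h4 := hc (V τ)
        rw [hτ] at h4
        exact h4
    rw [intervalIntegral.integral_const_mul] at h2
    change y t - y p ≤ _ at h1
    linarith
  suffices hfin : y t - y s + c * ∫ τ in s..t, y τ ^ a ≤ 0 by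
    change y t - y s ≤ _
    linarith
  rcases hs.eq_or_lt with rfl | hs'
  · rcases hst.eq_or_lt with rfl | hst'
    · simp
    have hcont : ContinuousOn (fun p => y t - y p + c * ∫ τ in p..t, y τ ^ a) (Icc 0 t) := by
      refine ((continuousOn_const).sub (hyc.mono (Icc_subset_Icc le_rfl ht))).add
        (continuousOn_const.mul ?_)
      have := intervalIntegral.continuousOn_primitive_interval_left (μ := volume)
        (f := fun τ => y τ ^ a) (a := 0) (b := t)
        ((hyac.mono (by rw [uIcc_of_le hst]; exact Icc_subset_Icc le_rfl ht)).integrableOn_compact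
          isCompact_uIcc)
      rwa [uIcc_of_le hst] at this
    have hcl : (0 : ℝ) ∈ closure (Ioc 0 t) := by
      rw [closure_Ioc hst'.ne]; exact ⟨le_rfl, hst⟩
    refine ContinuousWithinAt.closure_le hcl
      ((hcont 0 ⟨le_rfl, hst⟩).mono Ioc_subset_Icc_self) continuousWithinAt_const
      fun p hp => hpos p hp.1 hp.2
  · exact hpos s hs' hst

end IsWeakSolution

end FastDiffusion

theorem theorem4p2 (N : ℕ) (hN : 1 ≤ N) (m : ℝ) (hm0 : 0 < m) (hm1 : m < 1)
    (Ω : TopologicalSpace.Opens (EuclideanSpace ℝ (Fin N)))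
    (hΩ : Bornology.IsBounded (Ω : Set (EuclideanSpace ℝ (Fin N))))
    (u₀ : EuclideanSpace ℝ (Fin N) → ℝ)
    (hu₀ : ∀ᵐ x ∂(volume.restrict (Ω : Set (EuclideanSpace ℝ (Fin N)))), 0 ≤ u₀ x)
    (hu₀int : ∃ θ₀ : ℝ, 0 < θ₀ ∧
      MemLp u₀ (ENNReal.ofReal (1 + θ₀))
        (volume.restrict (Ω : Set (EuclideanSpace ℝ (Fin N))))) :
    ∃ t₀ : ℝ, 0 < t₀ ∧
      ∀ (T : ℝ) (u : ℝ → EuclideanSpace ℝ (Fin N) → ℝ), 0 < T →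
        FastDiffusion.IsRegularSolution m Ω u₀ T u →
          ∀ t : ℝ, t₀ < t → t ≤ T →
            ∀ᵐ x ∂(volume.restrict (Ω : Set (EuclideanSpace ℝ (Fin N)))), u t x = 0 := by
  open FastDiffusion in
  have hb := isSlowRate_betaDeriv hm0 hm1
  have he₀ : 0 < 1 / m - 1 := by
    rw [sub_pos, lt_div_iff₀ hm0]; linarith
  obtain ⟨p₀, hp₀, hsob⟩ := exists_sobolev hN hΩ
  obtain ⟨δ, hδ, hδe, hδ1, hδp⟩ : ∃ δ : ℝ, 0 < δ ∧ 4 * δ ≤ 1 / m - 1 ∧ 2 * δ ≤ 1 ∧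
      2 + 4 * δ ≤ p₀ := by
    refine ⟨min ((1 / m - 1) / 4) (min (1 / 2) ((p₀ - 2) / 4)), ?_, ?_, ?_, ?_⟩
    · have : 0 < p₀ - 2 := by linarith
      positivity
    · linarith [min_le_left ((1 / m - 1) / 4) (min (1 / 2) ((p₀ - 2) / 4))]
    · linarith [min_le_right ((1 / m - 1) / 4) (min (1 / 2) ((p₀ - 2) / 4)),
        min_le_left (1 / 2) ((p₀ - 2) / 4)]
    · linarith [min_le_right ((1 / m - 1) / 4) (min (1 / 2) ((p₀ - 2) / 4)),
        min_le_right (1 / 2) ((p₀ - 2) / 4)]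
  obtain ⟨S, hS⟩ := hsob (2 + 4 * δ) (by linarith) hδp
  obtain ⟨Φ, hΦ⟩ := exists_isArsinhComp Ω
  obtain ⟨c, hc, hdiss⟩ := hΦ.exists_dissipation hb hδ hδe hS
  set a := 2 / (2 + 4 * δ) with ha
  have ha0 : 0 < a := by positivity
  have ha1 : a < 1 := by rw [ha, div_lt_one (by linarith)]; linarith
  have h1a : 0 < 1 - a := by linarith
  set y₀ : ℝ := ∫ x in (Ω : Set (Eucl N)), rateEnergy (betaDeriv m) (H m (u₀ x ^ m)) with hy₀
  have hy₀0 : 0 ≤ y₀ := integral_nonneg fun x => hb.rateEnergy_nonneg _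
  refine ⟨y₀ ^ (1 - a) / ((1 - a) * c) + 1, by positivity, fun T u hT hu t ht htT => ?_⟩
  have hfin := isFiniteMeasure_restrict_of_isBounded hΩ
  obtain ⟨v, V, hv, hvu⟩ := hu.exists_isWeakSolution hm0 hm1
  have hq : 0 ≤ y₀ ^ (1 - a) / ((1 - a) * c) := by positivity
  have ht0 : 0 ≤ t := by linarith
  have hy0 : ∫ x in (Ω : Set (Eucl N)), rateEnergy (betaDeriv m) (v 0 x) = y₀ := by
    refine integral_congr_ae ?_
    filter_upwards [hvu 0 ⟨le_rfl, hT.le⟩, hu.initial] with x hx1 hx2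
    rw [hx1, hx2]
  have hzero := eq_zero_of_integral_ineq ha0 ha1 hc (hv.continuousOn_energy hΩ hb he₀)
    (fun t _ => integral_nonneg fun x => hb.rateEnergy_nonneg _)
    (fun s t hs hst ht => hv.energy_sub_le_neg_integral_rpow hT hΩ hb hδ hδe hδ1 hS hΦ hdiss
      hs hst ht) ht0 (by simp only [hy0]; linarith) htT
  obtain ⟨C, hC, hlip⟩ := hb.exists_rateEnergy_lipschitz he₀
  have hae := (integral_eq_zero_iff_of_nonneg (fun x => hb.rateEnergy_nonneg _)
    (integrable_comp_of_quadratic_lipschitz hlip (v t))).1 hzero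
  filter_upwards [hae, hvu t ⟨ht0, htT⟩, hu.nonneg t ⟨ht0, htT⟩] with x hx1 hx2 hx3
  have hum : 0 ≤ u t x ^ m := Real.rpow_nonneg hx3 m
  have hH : v t x ≤ 0 := by
    by_contra hcon
    exact (hb.rateEnergy_pos (not_le.1 hcon)).ne' hx1
  rw [hx2] at hH
  exact (Real.rpow_eq_zero hx3 hm0.ne').1 (le_antisymm ((le_H hm0 hm1 hum).trans hH) hum)
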